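/- **Notation.** Let $A$ be the Neumann Laplacian on $L^2(0,1)$, $D(A)=\{h\in W^{2,2}(0,1): h'(0)=h'(1)=0\}$, let $B=\partial_\theta$, and let $H=D((-A)^{-1/2})$ with norm $\|h\|_H^2=\sum_{i\ge1}(i\pi)^{-2}\langle h,e_i\rangle^2+\langle h,e_0\rangle^2$, where $e_0=1$, $e_i(\theta)=\sqrt2\cos(i\pi\theta)$ are the eigenvectors of $A$ and $\langle u,v\rangle=\int_0^1uv\,d\theta$. For $\lambda\in\mathbb R$ let $f(u)=\ln\frac{1-u}{1+u}+\lambda u$ for $u\in(-1,1)$, $f(u)=+\infty$ for $u\le-1$, $f(u)=-\infty$ for $u\ge1$. For $0\le s\le t$ put $O_{s,t}=[s,t]\times[0,1]$, $O_T=O_{0,T}$, and write $\langle v,\zeta\rangle_{O_{s,t}}=\int_{O_{s,t}}v\,d\zeta$ for a measure $\zeta$. **Weak solutions.** Let $T>0$ and $x\in C([0,1];[-1,1])$. A weak solution on $[0,T]$, with initial condition $x$, of the stochastic Cahn–Hilliard equation with two reflections $$dX=-\tfrac12A\big(AX+f(X)+\eta_--\eta_+\big)\,dt+B\,dW$$ is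 a quadruple $(X,\eta_+,\eta_-,W)$ defined on a filtered probability space $(\Omega,\mathbb P,\mathcal F,(\mathcal F_t)_{t\in[0,T]})$ such that: (a) a.s. $X\in C((0,T]\times[0,1];[-1,1])\cap C([0,T];H)$ and $X(0,\theta)=x(\theta)$ for all $\theta\in[0,1]$; (b) a.s. $\eta_+$ and $\eta_-$ are positive measures on $(0,T]\times[0,1]$ with $\eta_\pm(O_{\delta,T})<\infty$ for all $\delta\in(0,T]$; (c) $W=(W_t(g))_{t\in[0,T],\,g\in L^2(0,1)}$ is a cylindrical Wiener process on $L^2(0,1)$: a centred Gaussian family with $\mathbb E[W_s(g)W_t(h)]=\min(s,t)\langle g,h\rangle$, such that each $t\mapsto W_t(g)$ is a.s. continuous; (d) $(X,W)$ is $(\mathcal F_t)$-adapted; (e) a.s. $f(X)\in L^1(O_T)$ (in particular $f(X)$ is finite a.e. on $O_T$); (f) for all $h\in D(A^2)$ and all $0<\delta\le t\le T$, a.s. $$\begin{aligned}\langle X(t),h\rangle={}&\langle X(\delta),h\rangle-\tfrac12\int_\delta^t\langle X(s),A^2h\rangle\,ds-\tfrac12\int_\delta^t\langle Ah,f(X(s))\rangle\,ds\\&-\tfrac12\langle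 Ah,\eta_-\rangle_{O_{\delta,t}}+\tfrac12\langle Ah,\eta_+\rangle_{O_{\delta,t}}-\int_\delta^t\langle Bh,dW\rangle,\end{aligned}$$ where $\int_\delta^t\langle Bh,dW\rangle=W_t(Bh)-W_\delta(Bh)$; (g) a.s. $\langle 1+X,\eta_-\rangle_{O_T}=\langle 1-X,\eta_+\rangle_{O_T}=0$. **Proposition 2.1 (pathwise uniqueness).** Let $T>0$, $\lambda\in\mathbb R$ and $x\in C([0,1];[-1,1])$. Let $(X^i,\eta^i_+,\eta^i_-,W)$, $i=1,2$, be two weak solutions on $[0,T]$ with initial condition $x$, defined on the same probability space with the same $W$ (the filtrations may differ). Then, almost surely, $X^1(t,\theta)=X^2(t,\theta)$ for all $(t,\theta)\in[0,T]\times[0,1]$, $\eta^1_+=\eta^2_+$ and $\eta^1_-=\eta^2_-$. -/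

import Mathlib

open MeasureTheory ProbabilityTheory Filter Set Topology

noncomputable section

namespace ReflectedCahnHilliard

/-- Lebesgue measure on the space interval `[0,1]`. -/
abbrev spaceMeasure : Measure ℝ := volume.restrict (Icc (0 : ℝ) 1)

/-- The real Hilbert space `L²(0,1)`. -/
abbrev L2 : Type := Lp ℝ 2 spaceMeasure

/-- The pairing `⟨u, v⟩ = ∫₀¹ u(θ) v(θ) dθ` (scalar product of `L²(0,1)`, or the duality between
`L¹(0,1)` and `L^∞(0,1)`). -/
def pairing (u v : ℝ → ℝ) : ℝ := ∫ θ in (0 : ℝ)..1, u θ * v θ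

/-- The strip `O_{s,t} = [s,t] × [0,1]`. -/
def strip (s t : ℝ) : Set (ℝ × ℝ) := Icc s t ×ˢ Icc (0 : ℝ) 1

/-- `IsNeumann h dh g` says that `h ∈ W^{2,2}(0,1)` with `h' = dh`, `h'' = g` and
`h'(0) = h'(1) = 0`; that is, `h ∈ D(A)`, `Bh = dh` and `Ah = g`, with `A` the Neumann Laplacian
on `L²(0,1)`. The functions `h` and `dh` are the (absolutely) continuous representatives on
`[0,1]`. -/
structure IsNeumann (h dh g : ℝ → ℝ) : Prop where
  memLp : MemLp h 2 spaceMeasure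
  memLp_deriv : MemLp dh 2 spaceMeasure
  memLp_deriv_two : MemLp g 2 spaceMeasure
  eq_integral : ∀ θ ∈ Icc (0 : ℝ) 1, h θ = h 0 + ∫ r in (0 : ℝ)..θ, dh r
  deriv_eq_integral : ∀ θ ∈ Icc (0 : ℝ) 1, dh θ = dh 0 + ∫ r in (0 : ℝ)..θ, g r
  left_boundary : dh 0 = 0
  right_boundary : dh 1 = 0

/-- The orthonormal basis of `L²(0,1)` of eigenvectors of `A`: `e₀ = 1` and
`eᵢ(θ) = √2 cos(iπθ)` for `i ≥ 1`, with eigenvalues `-(iπ)²`. -/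
def eigenfunction (i : ℕ) (θ : ℝ) : ℝ :=
  if i = 0 then 1 else √2 * Real.cos (i * Real.pi * θ)

/-- The norm of `H = V_{-1} = D((-A)^{-1/2})`, on functions:
`‖h‖² = ∑_{i ≥ 1} (iπ)⁻² hᵢ² + h₀²`, where `hᵢ = ⟨h, eᵢ⟩` and `h₀` is the mean of `h`. -/
def normH (h : ℝ → ℝ) : ℝ :=
  √((∑' i : ℕ, (((i + 1 : ℕ) * Real.pi) ^ 2)⁻¹ * pairing h (eigenfunction (i + 1)) ^ 2) +
    pairing h (eigenfunction 0) ^ 2)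

/-- The nonlinearity `f`, with the infinite values `+∞` on `(-∞,-1]` and `-∞` on `[1,∞)`. -/
def f (lam : ℝ) (x : ℝ) : EReal :=
  if x ≤ -1 then ⊤
  else if 1 ≤ x then ⊥
  else ((Real.log ((1 - x) / (1 + x)) + lam * x : ℝ) : EReal)

/-- A cylindrical Wiener process on `L²(0,1)`, with time parameter in `[0,T]`: a centred Gaussian
family `W t g` with `E[(W s g) (W t h)] = min s t * ⟨g, h⟩`, such that each `W · g` has almost
surely continuous paths. -/
structure IsCylindricalWiener {Ω : Type*} [MeasurableSpace Ω] (P : Measure Ω) (T : ℝ)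
    (W : Icc (0 : ℝ) T → L2 → Ω → ℝ) : Prop where
  gaussian : IsGaussianProcess (fun (p : Icc (0 : ℝ) T × L2) ω => W p.1 p.2 ω) P
  centered : ∀ t g, ∫ ω, W t g ω ∂P = 0
  covariance : ∀ s t g h,
    ∫ ω, W s g ω * W t h ω ∂P = min (s : ℝ) (t : ℝ) * inner ℝ g h
  continuous_paths : ∀ g, ∀ᵐ ω ∂P, Continuous fun t => W t g ω

/-- `(X, η₊, η₋, W)` is a weak solution on `[0,T]`, on the filtered probability space
`(Ω, P, 𝓕)` and with initial condition `x`, of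
`dX = -½ A (A X + f(X) + η₋ - η₊) dt + B dW`, with reflection at `-1` and `1`.
Here `X ω t θ` is the value at time `t` and point `θ`, and a measure on `(0,T] × [0,1]` is a
measure on `ℝ × ℝ` that does not charge the complement of this set. -/
structure IsWeakSolution {Ω : Type*} {mΩ : MeasurableSpace Ω} (P : Measure Ω) (lam T : ℝ)
    (𝓕 : Filtration (Icc (0 : ℝ) T) mΩ) (x : ℝ → ℝ) (X : Ω → ℝ → ℝ → ℝ)
    (ηp ηm : Ω → Measure (ℝ × ℝ)) (W : Icc (0 : ℝ) T → L2 → Ω → ℝ) : Prop where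
  continuousOn : ∀ᵐ ω ∂P,
    ContinuousOn (fun p : ℝ × ℝ => X ω p.1 p.2) (Ioc 0 T ×ˢ Icc (0 : ℝ) 1)
  mem_Icc : ∀ᵐ ω ∂P, ∀ t ∈ Ioc 0 T, ∀ θ ∈ Icc (0 : ℝ) 1, X ω t θ ∈ Icc (-1 : ℝ) 1
  continuous_H : ∀ᵐ ω ∂P, ∀ t ∈ Icc 0 T,
    Tendsto (fun s => normH (fun θ => X ω s θ - X ω t θ)) (𝓝[Icc 0 T] t) (𝓝 0)
  initial : ∀ᵐ ω ∂P, ∀ θ ∈ Icc (0 : ℝ) 1, X ω 0 θ = x θ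
  carrier_plus : ∀ᵐ ω ∂P, ηp ω (Ioc 0 T ×ˢ Icc (0 : ℝ) 1)ᶜ = 0
  carrier_minus : ∀ᵐ ω ∂P, ηm ω (Ioc 0 T ×ˢ Icc (0 : ℝ) 1)ᶜ = 0
  finite_plus : ∀ᵐ ω ∂P, ∀ δ ∈ Ioc 0 T, ηp ω (strip δ T) < ⊤
  finite_minus : ∀ᵐ ω ∂P, ∀ δ ∈ Ioc 0 T, ηm ω (strip δ T) < ⊤
  wiener : IsCylindricalWiener P T W
  /- `X(t)` is `𝓕 t`-measurable as an `H`-valued random variable: the Borel sigma-algebra of `H`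
  is generated by the coordinates in the basis of eigenvectors. -/
  adapted_X : ∀ (t : Icc (0 : ℝ) T) (i : ℕ),
    Measurable[𝓕 t] fun ω => pairing (X ω t) (eigenfunction i)
  adapted_W : ∀ (t : Icc (0 : ℝ) T) (g : L2), Measurable[𝓕 t] (W t g)
  f_finite : ∀ᵐ ω ∂P, ∀ᵐ p ∂(volume.restrict (strip 0 T)),
    f lam (X ω p.1 p.2) ≠ ⊤ ∧ f lam (X ω p.1 p.2) ≠ ⊥
  f_integrable : ∀ᵐ ω ∂P,
    IntegrableOn (fun p : ℝ × ℝ => (f lam (X ω p.1 p.2)).toReal) (strip 0 T)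
  /- The equation tested against `h ∈ D(A²)`, where `dh = Bh`, `Ah`, `A2h = A²h`, and `b` is the
  class of `Bh` in `L²(0,1)`. Since `Bh` does not depend on time, the stochastic integral
  `∫_δ^t ⟨Bh, dW⟩` is `W t b - W δ b`. -/
  equation : ∀ h dh Ah dAh A2h : ℝ → ℝ, IsNeumann h dh Ah → IsNeumann Ah dAh A2h →
    ∀ b : L2, b =ᵐ[spaceMeasure] dh →
    ∀ δ t : Icc (0 : ℝ) T, 0 < (δ : ℝ) → δ ≤ t → ∀ᵐ ω ∂P,
      pairing (X ω t) h = pairing (X ω δ) h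
        - 1 / 2 * (∫ s in (δ : ℝ)..t, pairing (X ω s) A2h)
        - 1 / 2 * (∫ s in (δ : ℝ)..t, pairing Ah (fun θ => (f lam (X ω s θ)).toReal))
        - 1 / 2 * (∫ p in strip δ t, Ah p.2 ∂(ηm ω))
        + 1 / 2 * (∫ p in strip δ t, Ah p.2 ∂(ηp ω))
        - (W t b ω - W δ b ω)
  contact_minus : ∀ᵐ ω ∂P, ∫⁻ p in strip 0 T, ENNReal.ofReal (1 + X ω p.1 p.2) ∂(ηm ω) = 0
  contact_plus : ∀ᵐ ω ∂P, ∫⁻ p in strip 0 T, ENNReal.ofReal (1 - X ω p.1 p.2) ∂(ηp ω) = 0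

end ReflectedCahnHilliard

end

/-!
Almost surely, the difference of the two equations does not contain the noise, so the proof is a
deterministic argument for one path. Put `Y = X₁ - X₂`, let `y_m` be its coefficient on `cos (mπ·)`,
and let `μ_m = (mπ)²`.

*Paths.* The forces in the equation for `Y` are `λY` and a signed measure, written as a difference
of two positive measures (`upForce`): one acts only where `Y ≤ 0` and the other only where `Y ≥ 0`,
because `u ↦ ln ((1 - u) / (1 + u))` is decreasing and the reflections act only at `±1`. Formally,
`d‖Y‖²_H ≤ (-‖∂_θ Y‖² + λ‖Y‖²) dt`, and `λ - μ ≤ λ² / (4μ)` bounds the right-hand side by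
`(λ²/4) ‖Y‖²_H dt`. Since `Y` is merely continuous and the forces are measures, its cosine series
cannot be integrated against them; each mode is therefore multiplied by the Fourier weight of the
positive kernel `((1 + cos πu) / 2)ⁿ`. The weighted energy is a finite sum of squares of continuous
functions of bounded variation, to which the chain rule `sq_sub_sq_of_increments` applies, and the
weighted cosine sums converge to `Y` pointwise and boundedly (`tendsto_cosMean`, `abs_cosMean_le`).
Grönwall's inequality gives `energy_estimate` from any time `a > 0`. As `a → 0` the energy at time
`a` vanishes, by continuity in `H` and the common initial value, so that `Y = 0` (`path_eq`). The
mode `0`, invisible to the energy, vanishes since the mean is conserved.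

*Reflection measures.* Once `X₁ = X₂ = X`, the equation says that `η₋¹ + η₊²` and `η₋² + η₊¹` have
the same nonconstant cosine modes on every strip, hence differ by a multiple of Lebesgue measure in
space. At every positive time `|X| < 1` on a set of space points of positive length
(`IsReflectedPath.exists_mem_Ioo`, from conservation of the mean and finiteness of `f (X)`), where
all four measures vanish; thus the multiple is zero (`restrict_slab_eq`). Finally the sums are
separated by restricting them to the contact set `{X = -1}` and to its complement
(`reflection_eq`).
-/

open MeasureTheory ProbabilityTheory Filter Set Topology

namespace ReflectedCahnHilliard

/-! ### Cosine modes and a positive cosine kernel -/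

/-- The Neumann eigenfunction `θ ↦ cos (mπθ)`, not normalised. Indexing by `m : ℤ` rather than
`m : ℕ` matches the binomial expansion of `(1 + cos πu)ⁿ`. -/
noncomputable def cosMode (m : ℤ) (θ : ℝ) : ℝ := Real.cos (m * Real.pi * θ)

@[fun_prop]
lemma continuous_cosMode (m : ℤ) : Continuous (cosMode m) := by
  unfold cosMode; fun_prop

lemma abs_cosMode_le (m : ℤ) (θ : ℝ) : |cosMode m θ| ≤ 1 := Real.abs_cos_le_one _

lemma cosMode_zero (θ : ℝ) : cosMode 0 θ = 1 := by simp [cosMode]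

lemma cosMode_neg (m : ℤ) : cosMode (-m) = cosMode m := by
  funext θ
  simp [cosMode]

lemma cosMode_apply_neg (m : ℤ) (θ : ℝ) : cosMode m (-θ) = cosMode m θ := by
  simp [cosMode]

lemma cosMode_add_two (m : ℤ) (θ : ℝ) : cosMode m (θ + 2) = cosMode m θ := by
  unfold cosMode
  rw [← Real.cos_add_int_mul_two_pi (m * Real.pi * θ) m]
  congr 1; ring

/-- Binomial expansion of `cos(x/2)²ⁿ = ((1 + cos x) / 2)ⁿ`. -/
lemma half_one_add_cos_pow (n : ℕ) (x : ℝ) :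
    ((1 + Real.cos x) / 2) ^ n =
      (4⁻¹ : ℝ) ^ n * ∑ j ∈ Finset.range (2 * n + 1),
        ((2 * n).choose j : ℝ) * Real.cos (((j : ℤ) - (n : ℤ) : ℤ) * x) := by
  have h1 : (1 + Real.cos x) / 2 = 4⁻¹ * (2 * Real.cos (x / 2)) ^ 2 := by
    have := Real.cos_sq (x / 2)
    rw [mul_pow, this, mul_div_cancel₀ _ (two_ne_zero' ℝ)]
    ring
  rw [h1, mul_pow, ← pow_mul]
  congr 1
  have h2 : ((2 * Real.cos (x / 2) : ℝ) : ℂ) ^ (2 * n) =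
      ∑ j ∈ Finset.range (2 * n + 1), (((2 * n).choose j : ℝ) : ℂ) *
        Complex.exp (((((j : ℤ) - (n : ℤ) : ℤ) * x : ℝ) : ℂ) * Complex.I) := by
    push_cast
    rw [Complex.cos, mul_div_cancel₀ _ (two_ne_zero' ℂ), add_pow]
    refine Finset.sum_congr rfl fun j hj => ?_
    have hj' : j ≤ 2 * n := Nat.lt_succ_iff.mp (Finset.mem_range.mp hj)
    rw [← Complex.exp_nat_mul, ← Complex.exp_nat_mul, ← Complex.exp_add, mul_comm]
    congr 2
    push_cast [Nat.cast_sub hj']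
    ring
  have h3 := congrArg Complex.re h2
  rw [← Complex.ofReal_pow, Complex.ofReal_re, Complex.re_sum] at h3
  rw [h3]
  refine Finset.sum_congr rfl fun j _ => ?_
  rw [Complex.re_ofReal_mul, Complex.exp_ofReal_mul_I_re]

lemma integral_cosMode (m : ℤ) (hm : m ≠ 0) : ∫ u in (0 : ℝ)..1, cosMode m u = 0 := by
  have hm' : (m : ℝ) * Real.pi ≠ 0 := mul_ne_zero (by exact_mod_cast hm) Real.pi_ne_zero
  simp only [cosMode]
  rw [intervalIntegral.integral_comp_mul_left (fun y => Real.cos y) hm', integral_cos]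
  simp [Real.sin_int_mul_pi]

lemma integral_neg_one_one_eq {F : ℝ → ℝ} (hF : Continuous F) :
    ∫ u in (-1 : ℝ)..1, F u = ∫ u in (0 : ℝ)..1, (F u + F (-u)) := by
  have h1 : ∫ u in (-1 : ℝ)..0, F u = ∫ u in (0 : ℝ)..1, F (-u) := by
    rw [intervalIntegral.integral_comp_neg]; simp
  have h2 : Continuous fun u => F (-u) := hF.comp continuous_neg
  rw [← intervalIntegral.integral_add_adjacent_intervals (hF.intervalIntegrable _ 0)
    (hF.intervalIntegrable _ _), h1, intervalIntegral.integral_add (hF.intervalIntegrable _ _)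
    (h2.intervalIntegrable _ _), add_comm]

/-- The coefficient `⟨g, cos (mπ·)⟩` on `[0,1]`. -/
noncomputable def cosCoeff (g : ℝ → ℝ) (m : ℤ) : ℝ := pairing g (cosMode m)

/-- Convolution over a period of an even `2`-periodic function with a cosine acts as a Fourier
multiplier on the cosine coefficients. -/
lemma integral_cosMode_mul_translate {g : ℝ → ℝ} (hg : Continuous g)
    (heven : ∀ v, g (-v) = g v) (hper : ∀ v, g (v + 2) = g v) (m : ℤ) (θ : ℝ) :
    ∫ u in (-1 : ℝ)..1, cosMode m u * g (θ + u) = 2 * (cosCoeff g m * cosMode m θ) := by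
  have h1 : ∫ u in (-1 : ℝ)..1, cosMode m u * g (θ + u) =
      ∫ v in (θ + -1)..(θ + 1), cosMode m (v - θ) * g v := by
    rw [← intervalIntegral.integral_comp_add_left (fun v => cosMode m (v - θ) * g v) θ]
    simp
  have hP : Function.Periodic (fun v => cosMode m (v - θ) * g v) 2 := fun v => by
    simp only
    rw [hper, show v + 2 - θ = v - θ + 2 by ring, cosMode_add_two]
  have h2 : ∫ v in (θ + -1)..(θ + 1), cosMode m (v - θ) * g v =
      ∫ v in (-1 : ℝ)..1, cosMode m (v - θ) * g v := by
    have := hP.intervalIntegral_add_eq (θ + -1) (-1)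
    rw [show θ + -1 + 2 = θ + 1 by ring, show (-1 : ℝ) + 2 = 1 by norm_num] at this
    exact this
  rw [h1, h2, integral_neg_one_one_eq (by fun_prop), cosCoeff, pairing,
    ← intervalIntegral.integral_mul_const, ← intervalIntegral.integral_const_mul]
  refine intervalIntegral.integral_congr fun v _ => ?_
  simp only [heven, cosMode]
  rw [show (m : ℝ) * Real.pi * (v - θ) = m * Real.pi * v - m * Real.pi * θ by ring,
    show (m : ℝ) * Real.pi * (-v - θ) = -(m * Real.pi * v + m * Real.pi * θ) by ring,
    Real.cos_neg, Real.cos_sub, Real.cos_add]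
  ring

/-- The multipliers `C(2n,j) / C(2n,n) ∈ [0,1]` of the kernel `((1 + cos πu) / 2)ⁿ`, normalised;
the index `j` stands for the mode `j - n`. -/
noncomputable def binomWeight (n j : ℕ) : ℝ := ((2 * n).choose j : ℝ) / ((2 * n).choose n : ℝ)

lemma binomWeight_nonneg (n j : ℕ) : 0 ≤ binomWeight n j := by unfold binomWeight; positivity

lemma choose_mid_pos (n : ℕ) : (0 : ℝ) < ((2 * n).choose n : ℝ) := by
  exact_mod_cast Nat.choose_pos (by omega)

lemma binomWeight_le_one (n j : ℕ) : binomWeight n j ≤ 1 := by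
  unfold binomWeight
  rw [div_le_one (choose_mid_pos n)]
  exact_mod_cast Nat.choose_le_centralBinom j n

lemma tendsto_binomWeight (k : ℕ) : Tendsto (fun n => binomWeight n (n + k)) atTop (𝓝 1) := by
  induction k with
  | zero =>
    refine tendsto_const_nhds.congr fun n => ?_
    simp [binomWeight, (choose_mid_pos n).ne']
  | succ k ih =>
    have h1 : Tendsto (fun n : ℕ => (1 : ℝ) - (2 * k + 1) * ((n + k + 1 : ℕ) : ℝ)⁻¹) atTop
        (𝓝 1) := by
      have : Tendsto (fun n : ℕ => ((n + k + 1 : ℕ) : ℝ)⁻¹) atTop (𝓝 0) :=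
        tendsto_inv_atTop_nhds_zero_nat.comp (tendsto_add_atTop_nat (k + 1))
      simpa using (this.const_mul (2 * (k : ℝ) + 1)).const_sub 1
    have h2 := ih.mul h1
    rw [one_mul] at h2
    refine h2.congr' ?_
    filter_upwards [eventually_ge_atTop k] with n hn
    have h3 := Nat.choose_succ_right_eq (2 * n) (n + k)
    have h4 : (((2 * n).choose (n + k + 1) : ℕ) : ℝ) * (n + k + 1) =
        ((2 * n).choose (n + k) : ℝ) * (n - k) := by
      have := congrArg (fun z : ℕ => (z : ℝ)) h3
      rw [show 2 * n - (n + k) = n - k by omega] at this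
      push_cast [Nat.cast_sub hn] at this
      exact this
    have h5 : ((n : ℝ) + k + 1) ≠ 0 := by positivity
    unfold binomWeight
    rw [← add_assoc, eq_div_of_mul_eq h5 h4]
    push_cast
    field_simp
    ring

/-- The convolution of `g` with the normalised kernel `((1 + cos πu) / 2)ⁿ`, as a combination of
cosine modes. -/
noncomputable def cosMean (n : ℕ) (g : ℝ → ℝ) (θ : ℝ) : ℝ :=
  ∑ j ∈ Finset.range (2 * n + 1),
    binomWeight n j * (cosCoeff g ((j : ℤ) - n) * cosMode ((j : ℤ) - n) θ)

lemma half_one_add_cos_pi_pow (n : ℕ) (u : ℝ) :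
    ((1 + Real.cos (Real.pi * u)) / 2) ^ n = (4⁻¹ : ℝ) ^ n * ∑ j ∈ Finset.range (2 * n + 1),
      ((2 * n).choose j : ℝ) * cosMode ((j : ℤ) - n) u := by
  rw [half_one_add_cos_pow]
  simp only [cosMode, mul_assoc]

lemma integral_kernel (n : ℕ) : ∫ u in (-1 : ℝ)..1, ((1 + Real.cos (Real.pi * u)) / 2) ^ n =
    2 * (4⁻¹ : ℝ) ^ n * ((2 * n).choose n : ℝ) := by
  have h0 : ∀ m : ℤ, ∫ u in (-1 : ℝ)..1, cosMode m u = if m = 0 then 2 else 0 := fun m => by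
    rw [integral_neg_one_one_eq (by fun_prop)]
    simp only [cosMode_apply_neg]
    split_ifs with h
    · subst h; simp [cosMode_zero]; norm_num
    · rw [intervalIntegral.integral_add ((continuous_cosMode m).intervalIntegrable _ _)
        ((continuous_cosMode m).intervalIntegrable _ _), integral_cosMode m h, add_zero]
  simp only [half_one_add_cos_pi_pow]
  rw [intervalIntegral.integral_const_mul, intervalIntegral.integral_finsetSum fun j _ =>
    Continuous.intervalIntegrable (by fun_prop) _ _]
  simp only [intervalIntegral.integral_const_mul, h0]
  rw [Finset.sum_eq_single n]
  · simp; ring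
  · intro j _ hj
    rw [if_neg (by omega), mul_zero]
  · intro h; simp at h; omega

lemma cosMean_eq_integral {g : ℝ → ℝ} (hg : Continuous g)
    (heven : ∀ v, g (-v) = g v) (hper : ∀ v, g (v + 2) = g v) (n : ℕ) (θ : ℝ) :
    cosMean n g θ = (∫ u in (-1 : ℝ)..1, ((1 + Real.cos (Real.pi * u)) / 2) ^ n)⁻¹ *
      ∫ u in (-1 : ℝ)..1, ((1 + Real.cos (Real.pi * u)) / 2) ^ n * g (θ + u) := by
  rw [integral_kernel]
  have h1 : ∫ u in (-1 : ℝ)..1, ((1 + Real.cos (Real.pi * u)) / 2) ^ n * g (θ + u) =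
      (4⁻¹ : ℝ) ^ n * ∑ j ∈ Finset.range (2 * n + 1), ((2 * n).choose j : ℝ) *
        (2 * (cosCoeff g ((j : ℤ) - n) * cosMode ((j : ℤ) - n) θ)) := by
    simp only [half_one_add_cos_pi_pow, mul_assoc, Finset.sum_mul]
    rw [intervalIntegral.integral_const_mul, intervalIntegral.integral_finsetSum fun j _ =>
      Continuous.intervalIntegrable (by fun_prop) _ _]
    simp only [intervalIntegral.integral_const_mul,
      integral_cosMode_mul_translate hg heven hper]
  have h4 : ((4⁻¹ : ℝ) ^ n) ≠ 0 := by positivity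
  have h5 := (choose_mid_pos n).ne'
  rw [h1, Finset.mul_sum, Finset.mul_sum, cosMean]
  refine Finset.sum_congr rfl fun j _ => ?_
  unfold binomWeight
  field_simp

/-- The cosine means converge pointwise. -/
lemma tendsto_cosMean {g : ℝ → ℝ} (hg : Continuous g)
    (heven : ∀ v, g (-v) = g v) (hper : ∀ v, g (v + 2) = g v) (θ : ℝ) :
    Tendsto (fun n => cosMean n g θ) atTop (𝓝 (g θ)) := by
  have key := tendsto_setIntegral_pow_smul_of_unique_maximum_of_isCompact_of_continuousOn
    (μ := (volume : Measure ℝ)) (s := Icc (-1 : ℝ) 1) (x₀ := 0) (g := fun u => g (θ + u))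
    (c := fun u => (1 + Real.cos (Real.pi * u)) / 2) isCompact_Icc (by fun_prop) ?_ ?_ ?_ ?_
    (by fun_prop)
  · simp only [add_zero] at key
    refine key.congr fun n => ?_
    rw [cosMean_eq_integral hg heven hper, intervalIntegral.integral_of_le (by norm_num),
      intervalIntegral.integral_of_le (by norm_num), integral_Icc_eq_integral_Ioc,
      integral_Icc_eq_integral_Ioc]
    simp only [smul_eq_mul]
  · intro y hy hy0
    simp only [mul_zero, Real.cos_zero]
    have : Real.cos (Real.pi * y) < 1 := by
      refine lt_of_le_of_ne (Real.cos_le_one _) fun h => hy0 ?_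
      have hp := Real.pi_pos
      have := (Real.cos_eq_one_iff_of_lt_of_lt (x := Real.pi * y) (by nlinarith [hy.1])
        (by nlinarith [hy.2])).1 h
      simpa [hp.ne'] using this
    linarith
  · intro y _
    linarith [Real.neg_one_le_cos (Real.pi * y)]
  · simp
  · rw [interior_Icc, closure_Ioo (by norm_num)]; constructor <;> norm_num

/-- The cosine means do not increase the sup norm, since the kernel is positive. -/
lemma abs_cosMean_le {g : ℝ → ℝ} (hg : Continuous g)
    (heven : ∀ v, g (-v) = g v) (hper : ∀ v, g (v + 2) = g v) {C : ℝ} (hC : ∀ v, |g v| ≤ C)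
    (n : ℕ) (θ : ℝ) : |cosMean n g θ| ≤ C := by
  rw [cosMean_eq_integral hg heven hper]
  set K : ℝ → ℝ := fun u => ((1 + Real.cos (Real.pi * u)) / 2) ^ n with hK
  have hKc : Continuous K := by fun_prop
  have hK0 : ∀ u, 0 ≤ K u := fun u => by
    have := Real.neg_one_le_cos (Real.pi * u)
    exact pow_nonneg (by linarith) n
  have hZ : 0 < ∫ u in (-1 : ℝ)..1, K u := by
    rw [integral_kernel]
    have := choose_mid_pos n
    positivity
  rw [abs_mul, abs_of_pos (inv_pos.2 hZ), inv_mul_le_iff₀ hZ, mul_comm,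
    ← intervalIntegral.integral_const_mul]
  refine (intervalIntegral.abs_integral_le_integral_abs (by norm_num)).trans ?_
  refine intervalIntegral.integral_mono_on (by norm_num)
    (Continuous.intervalIntegrable (by fun_prop) _ _)
    (Continuous.intervalIntegrable (by fun_prop) _ _) fun u _ => ?_
  change |K u * _| ≤ _
  rw [abs_mul, abs_of_nonneg (hK0 u), mul_comm]
  exact mul_le_mul_of_nonneg_right (hC _) (hK0 u)

/-- The retraction of `ℝ` onto `[0,1]` by even reflection and `2`-periodicity. -/
noncomputable def fold (θ : ℝ) : ℝ := Real.arccos (Real.cos (Real.pi * θ)) / Real.pi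

@[fun_prop]
lemma continuous_fold : Continuous fold := by
  unfold fold
  exact (Real.continuous_arccos.comp (by fun_prop)).div_const _

lemma fold_neg (θ : ℝ) : fold (-θ) = fold θ := by simp [fold]

lemma fold_add_two (θ : ℝ) : fold (θ + 2) = fold θ := by
  unfold fold
  rw [show Real.pi * (θ + 2) = Real.pi * θ + 2 * Real.pi by ring, Real.cos_add_two_pi]

lemma fold_mem (θ : ℝ) : fold θ ∈ Icc (0 : ℝ) 1 :=
  ⟨div_nonneg (Real.arccos_nonneg _) Real.pi_pos.le,
    (div_le_one Real.pi_pos).2 (Real.arccos_le_pi _)⟩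

lemma fold_of_mem {θ : ℝ} (h : θ ∈ Icc (0 : ℝ) 1) : fold θ = θ := by
  unfold fold
  rw [Real.arccos_cos (mul_nonneg Real.pi_pos.le h.1)
    (by nlinarith [Real.pi_pos, h.2]), mul_div_cancel_left₀ _ Real.pi_ne_zero]

lemma cosCoeff_congr {g g' : ℝ → ℝ} (h : EqOn g g' (Icc 0 1)) (m : ℤ) :
    cosCoeff g m = cosCoeff g' m := by
  refine intervalIntegral.integral_congr fun θ hθ => ?_
  rw [uIcc_of_le zero_le_one] at hθ
  simp only [h hθ]

/-! ### Chain rule and Grönwall inequality for paths driven by measures -/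

/-- The strip `(s,t] × [0,1]`, open on the left so that consecutive strips are disjoint. -/
def slab (s t : ℝ) : Set (ℝ × ℝ) := Ioc s t ×ˢ Icc (0 : ℝ) 1

lemma measurableSet_slab (s t : ℝ) : MeasurableSet (slab s t) :=
  measurableSet_Ioc.prod measurableSet_Icc

lemma measurableSet_strip (s t : ℝ) : MeasurableSet (strip s t) :=
  measurableSet_Icc.prod measurableSet_Icc

lemma slab_subset_strip (s t : ℝ) : slab s t ⊆ strip s t :=
  prod_mono Ioc_subset_Icc_self Subset.rfl

lemma slab_mono {a s t b : ℝ} (h₁ : a ≤ s) (h₂ : t ≤ b) : slab s t ⊆ slab a b :=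
  prod_mono (Ioc_subset_Ioc h₁ h₂) Subset.rfl

lemma slab_self (s : ℝ) : slab s s = ∅ := by simp [slab]

lemma slab_union {a s t : ℝ} (h₁ : a ≤ s) (h₂ : s ≤ t) : slab a s ∪ slab s t = slab a t := by
  rw [slab, slab, ← union_prod, Ioc_union_Ioc_eq_Ioc h₁ h₂, slab]

lemma disjoint_slab (a s t : ℝ) : Disjoint (slab a s) (slab s t) :=
  Disjoint.set_prod_left (Ioc_disjoint_Ioc_of_le le_rfl) _ _

lemma integrableOn_slab {μ : Measure (ℝ × ℝ)} [IsFiniteMeasure μ] {φ : ℝ × ℝ → ℝ}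
    (hφ : Continuous φ) (s t : ℝ) : IntegrableOn φ (slab s t) μ :=
  (hφ.continuousOn.integrableOn_compact (isCompact_Icc.prod isCompact_Icc)).mono_set
    (slab_subset_strip s t)

lemma setIntegral_slab_sub {μ : Measure (ℝ × ℝ)} {φ : ℝ × ℝ → ℝ} {a s t : ℝ}
    (hφ : IntegrableOn φ (slab a t) μ) (h₁ : a ≤ s) (h₂ : s ≤ t) :
    ∫ p in slab a t, φ p ∂μ - ∫ p in slab a s, φ p ∂μ = ∫ p in slab s t, φ p ∂μ := by
  rw [← slab_union h₁ h₂, setIntegral_union (disjoint_slab a s t) (measurableSet_slab s t)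
    (hφ.mono_set (slab_mono le_rfl h₂)) (hφ.mono_set (slab_mono h₁ le_rfl))]
  ring

/-- An increment bound that holds on short intervals holds on all intervals, if the bound is
additive. -/
lemma abs_sub_le_of_forall_short {e V : ℝ → ℝ} {a b δ ε : ℝ} (hab : a ≤ b) (hδ : 0 < δ)
    (h : ∀ s t, a ≤ s → s ≤ t → t ≤ b → t - s < δ → |e t - e s| ≤ ε * (V t - V s)) :
    |e b - e a| ≤ ε * (V b - V a) := by
  have key : ∀ k : ℕ, ∀ t, a ≤ t → t ≤ b → t - a ≤ k * (δ / 2) →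
      |e t - e a| ≤ ε * (V t - V a) := by
    intro k
    induction k with
    | zero =>
      intro t h₁ h₂ h₃
      have : t = a := le_antisymm (by simpa using h₃) h₁
      simp [this]
    | succ k ih =>
      intro t h₁ h₂ h₃
      push_cast at h₃
      have hs := ih (max a (t - δ / 2)) (le_max_left _ _)
        (max_le hab (by linarith)) (by
          rcases max_choice a (t - δ / 2) with hm | hm <;> rw [hm]
          · rw [sub_self]; positivity
          · linarith)
      have ht := h (max a (t - δ / 2)) t (le_max_left _ _) (max_le h₁ (by linarith)) h₂
        (by linarith [le_max_right a (t - δ / 2)])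
      have := abs_sub_le (e t) (e (max a (t - δ / 2))) (e a)
      linarith
  obtain ⟨k, hk⟩ := exists_nat_ge ((b - a) / (δ / 2))
  exact key k b hab le_rfl ((div_le_iff₀ (by positivity)).1 hk)

lemma abs_setIntegral_slab_le {μ : Measure (ℝ × ℝ)} [IsFiniteMeasure μ] {φ : ℝ × ℝ → ℝ}
    {s t C : ℝ} (h : ∀ p ∈ slab s t, |φ p| ≤ C) :
    |∫ p in slab s t, φ p ∂μ| ≤ C * μ.real (slab s t) := by
  rw [← Real.norm_eq_abs]
  exact norm_setIntegral_le_of_norm_le_const (measure_lt_top _ _) h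

/-- Chain rule for the square of a continuous path `y` of bounded variation whose increments are
given by a density and by two measures, integrated against a fixed function of space. As `y` is
continuous, possible time atoms of the measures do not contribute. -/
lemma sq_sub_sq_of_increments {α β : Measure (ℝ × ℝ)} [IsFiniteMeasure α] [IsFiniteMeasure β]
    {y g c : ℝ → ℝ} (hy : Continuous y) (hg : Continuous g) (hc : Continuous c)
    (hc1 : ∀ θ, |c θ| ≤ 1) {a b κ : ℝ} (hab : a ≤ b)
    (heq : ∀ s t, a ≤ s → s ≤ t → t ≤ b → y t - y s = (∫ r in s..t, g r) +
      κ * ((∫ p in slab s t, c p.2 ∂α) - ∫ p in slab s t, c p.2 ∂β)) :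
    y b ^ 2 - y a ^ 2 = 2 * (∫ r in a..b, y r * g r) +
      2 * κ * ((∫ p in slab a b, y p.1 * c p.2 ∂α) - ∫ p in slab a b, y p.1 * c p.2 ∂β) := by
  set e : ℝ → ℝ := fun t => y t ^ 2 - 2 * (∫ r in a..t, y r * g r) -
    2 * κ * ((∫ p in slab a t, y p.1 * c p.2 ∂α) - ∫ p in slab a t, y p.1 * c p.2 ∂β) with he
  set V : ℝ → ℝ := fun t => (∫ r in a..t, |g r|) +
    |κ| * (α.real (slab a t) + β.real (slab a t)) with hV
  suffices h : ∀ ε > 0, |e b - e a| ≤ ε * (V b - V a) by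
    have h0 : |e b - e a| ≤ 0 := by
      have hlim : Tendsto (fun ε : ℝ => ε * (V b - V a)) (𝓝[>] 0) (𝓝 0) := by
        have : Tendsto (fun ε : ℝ => ε * (V b - V a)) (𝓝 0) (𝓝 (0 * (V b - V a))) :=
          tendsto_id.mul_const _
        rw [zero_mul] at this
        exact this.mono_left nhdsWithin_le_nhds
      refine ge_of_tendsto hlim ?_
      filter_upwards [self_mem_nhdsWithin] with ε hε using h ε hε
    have h1 := sub_eq_zero.1 (abs_nonpos_iff.1 h0)
    simp only [he, slab_self, intervalIntegral.integral_same, setIntegral_empty] at h1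
    linarith
  intro ε hε
  obtain ⟨δ, hδ, hunif⟩ := Metric.uniformContinuousOn_iff.1
    ((isCompact_Icc (a := a) (b := b)).uniformContinuousOn_of_continuous hy.continuousOn)
    (ε / 2) (by positivity)
  refine abs_sub_le_of_forall_short hab hδ fun s t has hst htb hlen => ?_
  have hosc : ∀ r, s ≤ r → r ≤ t → |y t + y s - 2 * y r| ≤ ε := by
    intro r h₁ h₂
    have d₁ := hunif t ⟨by linarith, htb⟩ r ⟨by linarith, by linarith⟩
      (by rw [Real.dist_eq, abs_of_nonneg (by linarith)]; linarith)
    have d₂ := hunif s ⟨has, by linarith⟩ r ⟨by linarith, by linarith⟩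
      (by rw [Real.dist_eq, abs_sub_comm, abs_of_nonneg (by linarith)]; linarith)
    rw [Real.dist_eq, abs_lt] at d₁ d₂
    rw [abs_le]
    constructor <;> linarith
  have hdens : ∀ (μ : Measure (ℝ × ℝ)) [IsFiniteMeasure μ],
      |(y t + y s) * (∫ p in slab s t, c p.2 ∂μ) -
        2 * ∫ p in slab s t, y p.1 * c p.2 ∂μ| ≤ ε * μ.real (slab s t) := by
    intro μ _
    have i₁ : IntegrableOn (fun p : ℝ × ℝ => c p.2) (slab s t) μ :=
      integrableOn_slab (by fun_prop) s t
    have i₂ : IntegrableOn (fun p : ℝ × ℝ => y p.1 * c p.2) (slab s t) μ :=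
      integrableOn_slab (by fun_prop) s t
    rw [← integral_const_mul, ← integral_const_mul,
      ← integral_sub (i₁.const_mul _) (i₂.const_mul _)]
    refine abs_setIntegral_slab_le fun p hp => ?_
    rw [show (y t + y s) * c p.2 - 2 * (y p.1 * c p.2) = (y t + y s - 2 * y p.1) * c p.2 by ring,
      abs_mul]
    have := hosc p.1 hp.1.1.le hp.1.2
    nlinarith [hc1 p.2, abs_nonneg (c p.2)]
  have hleb : |(y t + y s) * (∫ r in s..t, g r) - 2 * ∫ r in s..t, y r * g r| ≤
      ε * ∫ r in s..t, |g r| := by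
    rw [← intervalIntegral.integral_const_mul, ← intervalIntegral.integral_const_mul,
      ← intervalIntegral.integral_sub (Continuous.intervalIntegrable (by fun_prop) _ _)
        (Continuous.intervalIntegrable (by fun_prop) _ _),
      ← intervalIntegral.integral_const_mul]
    refine (intervalIntegral.abs_integral_le_integral_abs hst).trans ?_
    refine intervalIntegral.integral_mono_on hst (Continuous.intervalIntegrable (by fun_prop) _ _)
      (Continuous.intervalIntegrable (by fun_prop) _ _) fun r hr => ?_
    rw [show (y t + y s) * g r - 2 * (y r * g r) = (y t + y s - 2 * y r) * g r by ring, abs_mul]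
    exact mul_le_mul_of_nonneg_right (hosc r hr.1 hr.2) (abs_nonneg _)
  have hμV : ∀ (μ : Measure (ℝ × ℝ)) [IsFiniteMeasure μ],
      μ.real (slab a t) - μ.real (slab a s) = μ.real (slab s t) := by
    intro μ _
    rw [← slab_union has hst, measureReal_union (disjoint_slab a s t) (measurableSet_slab s t)]
    ring
  have hVd : V t - V s = (∫ r in s..t, |g r|) +
      |κ| * (α.real (slab s t) + β.real (slab s t)) := by
    rw [← hμV α, ← hμV β]
    simp only [hV]
    rw [← intervalIntegral.integral_add_adjacent_intervals (a := a) (b := s)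
      (c := t) (Continuous.intervalIntegrable (by fun_prop) _ _)
        (Continuous.intervalIntegrable (by fun_prop) _ _)]
    ring
  have hed : e t - e s =
      ((y t + y s) * (∫ r in s..t, g r) - 2 * ∫ r in s..t, y r * g r) +
      κ * (((y t + y s) * (∫ p in slab s t, c p.2 ∂α) - 2 * ∫ p in slab s t, y p.1 * c p.2 ∂α) -
        ((y t + y s) * (∫ p in slab s t, c p.2 ∂β) - 2 * ∫ p in slab s t, y p.1 * c p.2 ∂β)) := by
    have hi : Continuous fun p : ℝ × ℝ => y p.1 * c p.2 := by fun_prop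
    rw [← setIntegral_slab_sub (integrableOn_slab (μ := α) hi a t) has hst,
      ← setIntegral_slab_sub (integrableOn_slab (μ := β) hi a t) has hst]
    simp only [he]
    rw [← intervalIntegral.integral_add_adjacent_intervals (a := a) (b := s)
      (c := t) (Continuous.intervalIntegrable (by fun_prop) _ _)
        (Continuous.intervalIntegrable (by fun_prop) _ _)]
    have := heq s t has hst htb
    linear_combination (y t + y s) * this
  rw [hed, hVd]
  have hα := hdens α
  have hβ := hdens β
  set P₁ := (y t + y s) * (∫ r in s..t, g r) - 2 * ∫ r in s..t, y r * g r
  set P₂ := (y t + y s) * (∫ p in slab s t, c p.2 ∂α) - 2 * ∫ p in slab s t, y p.1 * c p.2 ∂α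
  set P₃ := (y t + y s) * (∫ p in slab s t, c p.2 ∂β) - 2 * ∫ p in slab s t, y p.1 * c p.2 ∂β
  calc |P₁ + κ * (P₂ - P₃)| ≤ |P₁| + |κ| * |P₂ - P₃| := by
        rw [← abs_mul]; exact abs_add_le _ _
    _ ≤ |P₁| + |κ| * (|P₂| + |P₃|) := by
        gcongr; exact abs_sub _ _
    _ ≤ ε * (∫ r in s..t, |g r|) + |κ| * (ε * α.real (slab s t) + ε * β.real (slab s t)) := by
        gcongr
    _ = _ := by ring

/-- Grönwall's inequality in integral form. -/
lemma le_mul_exp_of_le_add_integral {u : ℝ → ℝ} (hu : Continuous u) {a b c C : ℝ}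
    (hC : 0 ≤ C) (h : ∀ t ∈ Icc a b, u t ≤ c + C * ∫ r in a..t, u r) {t : ℝ} (ht : t ∈ Icc a b) :
    u t ≤ c * Real.exp (C * (t - a)) := by
  set w : ℝ → ℝ := fun t => Real.exp (-(C * (t - a))) * (c + C * ∫ r in a..t, u r) with hw
  have hd : ∀ t, HasDerivAt w (Real.exp (-(C * (t - a))) * (-(C * 1)) *
      (c + C * ∫ r in a..t, u r) + Real.exp (-(C * (t - a))) * (C * u t)) t := by
    intro t
    have h1 : HasDerivAt (fun t => Real.exp (-(C * (t - a))))
        (Real.exp (-(C * (t - a))) * (-(C * 1))) t :=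
      (((hasDerivAt_id t).sub_const a).const_mul C).neg.exp
    exact h1.mul (((hu.integral_hasStrictDerivAt a t).hasDerivAt.const_mul C).const_add c)
  have hanti : AntitoneOn w (Icc a b) := by
    refine antitoneOn_of_deriv_nonpos (convex_Icc a b)
      (fun t _ => (hd t).continuousAt.continuousWithinAt)
      (fun t _ => (hd t).differentiableAt.differentiableWithinAt) fun t ht => ?_
    rw [interior_Icc] at ht
    rw [(hd t).deriv]
    have h1 := mul_le_mul_of_nonneg_left (h t ⟨ht.1.le, ht.2.le⟩)
      (mul_nonneg (Real.exp_pos (-(C * (t - a)))).le hC)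
    linarith
  have h1 := hanti ⟨le_rfl, ht.1.trans ht.2⟩ ht ht.1
  simp only [hw, intervalIntegral.integral_same, sub_self, mul_zero, neg_zero, Real.exp_zero,
    add_zero, one_mul] at h1
  rw [Real.exp_neg, inv_mul_le_iff₀ (Real.exp_pos _), mul_comm] at h1
  linarith [h t ht]

/-! ### Energy estimate -/

/-- The eigenvalue `(mπ)²` of `-A` on `cosMode m`. -/
noncomputable def eigenvalue (m : ℤ) : ℝ := ((m : ℝ) * Real.pi) ^ 2

lemma eigenvalue_nonneg (m : ℤ) : 0 ≤ eigenvalue m := sq_nonneg _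

lemma eigenvalue_pos {m : ℤ} (hm : m ≠ 0) : 0 < eigenvalue m := by
  have : (m : ℝ) ≠ 0 := by exact_mod_cast hm
  unfold eigenvalue
  positivity

lemma eigenvalue_zero : eigenvalue 0 = 0 := by simp [eigenvalue]

lemma continuous_cosCoeff {Z : ℝ → ℝ → ℝ} (hZ : Continuous (Function.uncurry Z)) (m : ℤ) :
    Continuous fun t => cosCoeff (Z t) m := by
  unfold cosCoeff pairing
  refine intervalIntegral.continuous_parametric_intervalIntegral_of_continuous' ?_ 0 1
  exact hZ.mul ((continuous_cosMode m).comp continuous_snd)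

lemma tendsto_integral_abs_cosMean_sub {Z : ℝ → ℝ → ℝ} (hZ : Continuous (Function.uncurry Z))
    (heven : ∀ t v, Z t (-v) = Z t v) (hper : ∀ t v, Z t (v + 2) = Z t v) {C : ℝ}
    (hC : ∀ t v, |Z t v| ≤ C) (μ : Measure (ℝ × ℝ)) [IsFiniteMeasure μ] :
    Tendsto (fun n => ∫ p, |cosMean n (Z p.1) p.2 - Z p.1 p.2| ∂μ) atTop (𝓝 0) := by
  have hZt : ∀ t, Continuous (Z t) := fun t => hZ.comp (by fun_prop : Continuous fun v => (t, v))
  have h0 : ∫ _ : ℝ × ℝ, (0 : ℝ) ∂μ = 0 := by simp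
  rw [← h0]
  refine tendsto_integral_of_dominated_convergence (fun _ => C + C) (fun n => ?_)
    (integrable_const _) (fun n => ?_) ?_
  · have hc : Continuous fun p : ℝ × ℝ => |cosMean n (Z p.1) p.2 - Z p.1 p.2| := by
      unfold cosMean
      refine (Continuous.sub (continuous_finsetSum _ fun j _ => ?_) hZ).abs
      exact continuous_const.mul (((continuous_cosCoeff hZ _).comp continuous_fst).mul
        ((continuous_cosMode _).comp continuous_snd))
    exact hc.aestronglyMeasurable
  · refine ae_of_all _ fun p => ?_
    rw [Real.norm_eq_abs, abs_abs]
    exact (abs_sub _ _).trans (add_le_add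
      (abs_cosMean_le (hZt _) (heven _) (hper _) (hC _) n _) (hC _ _))
  · refine ae_of_all _ fun p => ?_
    have := (tendsto_cosMean (hZt p.1) (heven _) (hper _) p.2).sub_const (Z p.1 p.2)
    simpa using this.abs

/-- Energy estimate for the difference `Z` of two solutions. The forces `α` and `β` push `Z`
towards `0`: `Z ≤ 0` where `α` acts and `Z ≥ 0` where `β` acts. Then the `H`-norm, weighted by
the multipliers of a positive kernel, grows at most exponentially; the weights turn `∫ Z dα` into
the integral of a finite cosine sum. -/
theorem energy_estimate {Z : ℝ → ℝ → ℝ} (hZ : Continuous (Function.uncurry Z))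
    (heven : ∀ t v, Z t (-v) = Z t v) (hper : ∀ t v, Z t (v + 2) = Z t v) {C : ℝ}
    (hC : ∀ t v, |Z t v| ≤ C) {α β : Measure (ℝ × ℝ)} [IsFiniteMeasure α] [IsFiniteMeasure β]
    {a b lam B : ℝ}
    (hα : ∀ᵐ p ∂α, p ∈ slab a b → Z p.1 p.2 ≤ 0) (hβ : ∀ᵐ p ∂β, p ∈ slab a b → 0 ≤ Z p.1 p.2)
    (heq : ∀ m s t, a ≤ s → s ≤ t → t ≤ b → cosCoeff (Z t) m - cosCoeff (Z s) m =
      (∫ r in s..t, 1 / 2 * (lam * eigenvalue m - eigenvalue m ^ 2) * cosCoeff (Z r) m) +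
      1 / 2 * eigenvalue m *
        ((∫ p in slab s t, cosMode m p.2 ∂α) - ∫ p in slab s t, cosMode m p.2 ∂β))
    (h0 : ∀ t ∈ Icc a b, cosCoeff (Z t) 0 = 0)
    (hB : ∀ n : ℕ, ∑ j ∈ Finset.range (2 * n + 1),
      (eigenvalue ((j : ℤ) - n))⁻¹ * cosCoeff (Z a) ((j : ℤ) - n) ^ 2 ≤ B)
    (k : ℕ) {t : ℝ} (ht : t ∈ Icc a b) :
    (eigenvalue k)⁻¹ * cosCoeff (Z t) k ^ 2 ≤ B * Real.exp (lam ^ 2 / 4 * (t - a)) := by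
  have hZt : ∀ t, Continuous (Z t) := fun t => hZ.comp (by fun_prop : Continuous fun v => (t, v))
  have hyc := continuous_cosCoeff hZ
  set ε : ℕ → ℝ := fun n => (∫ p, |cosMean n (Z p.1) p.2 - Z p.1 p.2| ∂α) +
    ∫ p, |cosMean n (Z p.1) p.2 - Z p.1 p.2| ∂β with hε
  have hεlim : Tendsto ε atTop (𝓝 0) := by
    simpa using (tendsto_integral_abs_cosMean_sub hZ heven hper hC α).add
      (tendsto_integral_abs_cosMean_sub hZ heven hper hC β)
  have hmeanc : ∀ n, Continuous fun p : ℝ × ℝ => cosMean n (Z p.1) p.2 := by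
    intro n
    unfold cosMean
    refine continuous_finsetSum _ fun j _ => ?_
    exact continuous_const.mul (((hyc _).comp continuous_fst).mul
      ((continuous_cosMode _).comp continuous_snd))
  have hZp : Continuous fun p : ℝ × ℝ => Z p.1 p.2 := hZ
  have herrc : ∀ (n : ℕ) (μ : Measure (ℝ × ℝ)) [IsFiniteMeasure μ],
      Integrable (fun p : ℝ × ℝ => |cosMean n (Z p.1) p.2 - Z p.1 p.2|) μ := by
    intro n μ _
    refine Integrable.of_bound (((hmeanc n).sub hZp).abs.aestronglyMeasurable) (C + C)
      (ae_of_all _ fun p => ?_)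
    rw [Real.norm_eq_abs, abs_abs]
    exact (abs_sub _ _).trans (add_le_add
      (abs_cosMean_le (hZt _) (heven _) (hper _) (hC _) n _) (hC _ _))
  -- the contribution of the forces is at most the approximation error
  have hαle : ∀ n t, t ≤ b → ∫ p in slab a t, cosMean n (Z p.1) p.2 ∂α ≤
      ∫ p, |cosMean n (Z p.1) p.2 - Z p.1 p.2| ∂α := by
    intro n t htb
    refine (setIntegral_mono_ae_restrict (integrableOn_slab (hmeanc n) a t)
      (herrc n α).integrableOn ?_).trans
      (setIntegral_le_integral (herrc n α) (ae_of_all _ fun p => abs_nonneg _))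
    filter_upwards [ae_restrict_of_ae hα, ae_restrict_mem (measurableSet_slab a t)] with p h₁ h₂
    have := h₁ (slab_mono le_rfl htb h₂)
    linarith [le_abs_self (cosMean n (Z p.1) p.2 - Z p.1 p.2)]
  have hβle : ∀ n t, t ≤ b → -∫ p in slab a t, cosMean n (Z p.1) p.2 ∂β ≤
      ∫ p, |cosMean n (Z p.1) p.2 - Z p.1 p.2| ∂β := by
    intro n t htb
    rw [← integral_neg]
    refine (setIntegral_mono_ae_restrict (integrableOn_slab (hmeanc n) a t).neg
      (herrc n β).integrableOn ?_).trans
      (setIntegral_le_integral (herrc n β) (ae_of_all _ fun p => abs_nonneg _))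
    filter_upwards [ae_restrict_of_ae hβ, ae_restrict_mem (measurableSet_slab a t)] with p h₁ h₂
    have := h₁ (slab_mono le_rfl htb h₂)
    simp only [Pi.neg_apply]
    linarith [neg_abs_le (cosMean n (Z p.1) p.2 - Z p.1 p.2)]
  have hmode : ∀ (m : ℤ) (w t : ℝ), 0 ≤ w → t ∈ Icc a b →
      w * ((eigenvalue m)⁻¹ * cosCoeff (Z t) m ^ 2) -
        w * ((eigenvalue m)⁻¹ * cosCoeff (Z a) m ^ 2) ≤
      lam ^ 2 / 4 * (∫ r in a..t, w * ((eigenvalue m)⁻¹ * cosCoeff (Z r) m ^ 2)) +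
      ((∫ p in slab a t, w * (cosCoeff (Z p.1) m * cosMode m p.2) ∂α) -
        ∫ p in slab a t, w * (cosCoeff (Z p.1) m * cosMode m p.2) ∂β) := by
    intro m w t hw ht
    rcases eq_or_ne m 0 with rfl | hm
    · have hz : ∀ μ : Measure (ℝ × ℝ), ∫ p in slab a t,
          w * (cosCoeff (Z p.1) 0 * cosMode 0 p.2) ∂μ = 0 := fun μ =>
        setIntegral_eq_zero_of_forall_eq_zero fun p hp => by
          rw [h0 p.1 ⟨hp.1.1.le, hp.1.2.trans ht.2⟩]; ring
      rw [hz, hz]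
      simp [eigenvalue_zero]
    · have hpos := eigenvalue_pos hm
      have hchain := sq_sub_sq_of_increments (hyc m)
        (g := fun r => 1 / 2 * (lam * eigenvalue m - eigenvalue m ^ 2) * cosCoeff (Z r) m)
        (continuous_const.mul (hyc m)) (continuous_cosMode m) (abs_cosMode_le m) ht.1
        (fun s t' h₁ h₂ h₃ => heq m s t' h₁ h₂ (h₃.trans ht.2))
      have hint : 2 * (eigenvalue m)⁻¹ * (∫ r in a..t, cosCoeff (Z r) m *
          (1 / 2 * (lam * eigenvalue m - eigenvalue m ^ 2) * cosCoeff (Z r) m)) ≤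
          lam ^ 2 / 4 * (∫ r in a..t, (eigenvalue m)⁻¹ * cosCoeff (Z r) m ^ 2) := by
        rw [← intervalIntegral.integral_const_mul, ← intervalIntegral.integral_const_mul]
        refine intervalIntegral.integral_mono_on ht.1
          (Continuous.intervalIntegrable (by fun_prop) _ _)
          (Continuous.intervalIntegrable (by fun_prop) _ _) fun r _ => ?_
        -- Young's inequality `λ - μ ≤ λ² / (4μ)`
        have hy : 0 ≤ (eigenvalue m)⁻¹ * ((lam / 2 - eigenvalue m) * cosCoeff (Z r) m) ^ 2 :=
          mul_nonneg (inv_nonneg.2 hpos.le) (sq_nonneg _)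
        have e1 : lam ^ 2 / 4 * ((eigenvalue m)⁻¹ * cosCoeff (Z r) m ^ 2) -
            2 * (eigenvalue m)⁻¹ * (cosCoeff (Z r) m *
              (1 / 2 * (lam * eigenvalue m - eigenvalue m ^ 2) * cosCoeff (Z r) m)) =
            (eigenvalue m)⁻¹ * ((lam / 2 - eigenvalue m) * cosCoeff (Z r) m) ^ 2 := by
          field_simp
          ring
        linarith
      simp only [intervalIntegral.integral_const_mul, integral_const_mul] at hint ⊢
      have hc := congrArg (fun z => w * ((eigenvalue m)⁻¹ * z)) hchain
      have e2 : (eigenvalue m)⁻¹ * eigenvalue m = 1 := inv_mul_cancel₀ hpos.ne'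
      have hint' := mul_le_mul_of_nonneg_left hint hw
      linear_combination hint' + hc + w * ((∫ p in slab a t, cosCoeff (Z p.1) m * cosMode m p.2 ∂α)
        - ∫ p in slab a t, cosCoeff (Z p.1) m * cosMode m p.2 ∂β) * e2
  have hq : ∀ n : ℕ, ∑ j ∈ Finset.range (2 * n + 1), binomWeight n j *
      ((eigenvalue ((j : ℤ) - n))⁻¹ * cosCoeff (Z t) ((j : ℤ) - n) ^ 2) ≤
      (B + ε n) * Real.exp (lam ^ 2 / 4 * (t - a)) := by
    intro n
    refine le_mul_exp_of_le_add_integral (b := b) (u := fun t =>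
      ∑ j ∈ Finset.range (2 * n + 1), binomWeight n j *
        ((eigenvalue ((j : ℤ) - n))⁻¹ * cosCoeff (Z t) ((j : ℤ) - n) ^ 2))
      (by fun_prop) (by positivity) (fun t ht => ?_) ht
    have hsum := Finset.sum_le_sum fun j (_ : j ∈ Finset.range (2 * n + 1)) =>
      hmode ((j : ℤ) - n) (binomWeight n j) t (binomWeight_nonneg n j) ht
    have hμ : ∀ (μ : Measure (ℝ × ℝ)) [IsFiniteMeasure μ],
        ∑ j ∈ Finset.range (2 * n + 1), ∫ p in slab a t, binomWeight n j *
          (cosCoeff (Z p.1) ((j : ℤ) - n) * cosMode ((j : ℤ) - n) p.2) ∂μ =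
        ∫ p in slab a t, cosMean n (Z p.1) p.2 ∂μ := by
      intro μ _
      unfold cosMean
      exact (integral_finsetSum _ fun j _ => integrableOn_slab (continuous_const.mul
        (((hyc _).comp continuous_fst).mul ((continuous_cosMode _).comp continuous_snd))) a t).symm
    rw [Finset.sum_sub_distrib, Finset.sum_add_distrib, Finset.sum_sub_distrib, hμ α, hμ β,
      ← Finset.mul_sum, ← intervalIntegral.integral_finsetSum fun j _ =>
        Continuous.intervalIntegrable (by fun_prop) _ _] at hsum
    have hinit : ∑ j ∈ Finset.range (2 * n + 1), binomWeight n j *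
        ((eigenvalue ((j : ℤ) - n))⁻¹ * cosCoeff (Z a) ((j : ℤ) - n) ^ 2) ≤ B := by
      refine (Finset.sum_le_sum fun j _ => ?_).trans (hB n)
      exact mul_le_of_le_one_left
        (mul_nonneg (inv_nonneg.2 (eigenvalue_nonneg _)) (sq_nonneg _)) (binomWeight_le_one n j)
    have := hαle n t ht.2
    have := hβle n t ht.2
    simp only [hε]
    linarith
  have hterm : ∀ n ≥ k, binomWeight n (n + k) * ((eigenvalue k)⁻¹ * cosCoeff (Z t) k ^ 2) ≤
      (B + ε n) * Real.exp (lam ^ 2 / 4 * (t - a)) := by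
    intro n hn
    refine le_trans ?_ (hq n)
    have := Finset.single_le_sum (f := fun j : ℕ => binomWeight n j *
      ((eigenvalue ((j : ℤ) - n))⁻¹ * cosCoeff (Z t) ((j : ℤ) - n) ^ 2))
      (s := Finset.range (2 * n + 1)) (fun j _ => mul_nonneg (binomWeight_nonneg n j)
        (mul_nonneg (inv_nonneg.2 (eigenvalue_nonneg _)) (sq_nonneg _)))
      (Finset.mem_range.2 (by omega : n + k < 2 * n + 1))
    simpa using this
  have hl := (tendsto_binomWeight k).mul_const ((eigenvalue k)⁻¹ * cosCoeff (Z t) k ^ 2)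
  have hr := (hεlim.const_add B).mul_const (Real.exp (lam ^ 2 / 4 * (t - a)))
  rw [one_mul] at hl
  rw [add_zero] at hr
  exact le_of_tendsto_of_tendsto hl hr ((eventually_ge_atTop k).mono hterm)

/-! ### Measures determined by cosine modes -/

/-- Cosine modes determine finite measures on `[0,1]`. -/
lemma measure_eq_of_integral_cosMode {μ ν : Measure ℝ} [IsFiniteMeasure μ] [IsFiniteMeasure ν]
    (hμ : ∀ᵐ θ ∂μ, θ ∈ Icc (0 : ℝ) 1) (hν : ∀ᵐ θ ∂ν, θ ∈ Icc (0 : ℝ) 1)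
    (h : ∀ m, ∫ θ, cosMode m θ ∂μ = ∫ θ, cosMode m θ ∂ν) : μ = ν := by
  refine ext_of_forall_integral_eq_of_IsFiniteMeasure fun φ => ?_
  set g : ℝ → ℝ := fun θ => φ (fold θ) with hg
  have hgc : Continuous g := φ.continuous.comp continuous_fold
  have heven : ∀ v, g (-v) = g v := fun v => by simp only [hg, fold_neg]
  have hper : ∀ v, g (v + 2) = g v := fun v => by simp only [hg, fold_add_two]
  have hbd : ∀ v, |g v| ≤ ‖φ‖ := fun v => φ.norm_coe_le_norm _
  have hlim : ∀ (ρ : Measure ℝ) [IsFiniteMeasure ρ], (∀ᵐ θ ∂ρ, θ ∈ Icc (0 : ℝ) 1) →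
      Tendsto (fun n => ∫ θ, cosMean n g θ ∂ρ) atTop (𝓝 (∫ θ, φ θ ∂ρ)) := by
    intro ρ _ hρ
    have e : ∫ θ, φ θ ∂ρ = ∫ θ, g θ ∂ρ := integral_congr_ae <| by
      filter_upwards [hρ] with θ hθ
      simp only [hg, fold_of_mem hθ]
    rw [e]
    refine tendsto_integral_of_dominated_convergence (fun _ => ‖φ‖) (fun n => ?_)
      (integrable_const _) (fun n => ae_of_all _ fun θ => abs_cosMean_le hgc heven hper hbd n θ)
      (ae_of_all _ fun θ => tendsto_cosMean hgc heven hper θ)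
    refine Continuous.aestronglyMeasurable ?_
    unfold cosMean
    fun_prop
  have hint : ∀ (ρ : Measure ℝ) [IsFiniteMeasure ρ] m, Integrable (cosMode m) ρ :=
    fun ρ _ m => Integrable.of_bound (continuous_cosMode m).aestronglyMeasurable 1
      (ae_of_all _ (abs_cosMode_le m))
  refine tendsto_nhds_unique (hlim μ hμ) ((hlim ν hν).congr fun n => ?_)
  unfold cosMean
  rw [integral_finsetSum _ fun j _ => ((hint ν _).const_mul _).const_mul _,
    integral_finsetSum _ fun j _ => ((hint μ _).const_mul _).const_mul _]
  simp only [integral_const_mul, h]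

/-- Two measures with the same nonconstant cosine modes on `(s,t] × [0,1]` have the same space
marginals, up to multiples of Lebesgue measure. -/
lemma marginal_add_eq {α β : Measure (ℝ × ℝ)} [IsFiniteMeasure α] [IsFiniteMeasure β] {s t : ℝ}
    (h : ∀ m : ℤ, m ≠ 0 →
      ∫ p in slab s t, cosMode m p.2 ∂α = ∫ p in slab s t, cosMode m p.2 ∂β)
    {J : Set ℝ} (hJ : MeasurableSet J) (hJ1 : J ⊆ Icc 0 1) :
    α.real (Ioc s t ×ˢ J) + β.real (slab s t) * volume.real J =
      β.real (Ioc s t ×ˢ J) + α.real (slab s t) * volume.real J := by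
  have hmain : (α.restrict (slab s t)).map Prod.snd + β (slab s t) • spaceMeasure =
      (β.restrict (slab s t)).map Prod.snd + α (slab s t) • spaceMeasure := by
    have hfin : ∀ (ρ : Measure (ℝ × ℝ)) [IsFiniteMeasure ρ],
        IsFiniteMeasure (ρ (slab s t) • spaceMeasure) := fun ρ _ =>
      Measure.smul_finite _ (measure_ne_top _ _)
    have hcar : ∀ (ρ ρ' : Measure (ℝ × ℝ)) [IsFiniteMeasure ρ'], ∀ᵐ θ ∂((ρ.restrict
        (slab s t)).map Prod.snd + ρ' (slab s t) • spaceMeasure), θ ∈ Icc (0 : ℝ) 1 := by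
      intro ρ ρ' _
      rw [ae_add_measure_iff]
      constructor
      · refine (ae_map_iff measurable_snd.aemeasurable
          (p := fun θ => θ ∈ Icc (0 : ℝ) 1) measurableSet_Icc).2 ?_
        filter_upwards [ae_restrict_mem (measurableSet_slab s t)] with p hp using hp.2
      · exact Measure.ae_smul_measure (ae_restrict_mem measurableSet_Icc) _
    have hint : ∀ (ρ : Measure ℝ) [IsFiniteMeasure ρ] m, Integrable (cosMode m) ρ :=
      fun ρ _ m => Integrable.of_bound (continuous_cosMode m).aestronglyMeasurable 1
        (ae_of_all _ (abs_cosMode_le m))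
    have hval : ∀ (ρ ρ' : Measure (ℝ × ℝ)) [IsFiniteMeasure ρ] [IsFiniteMeasure ρ'] m,
        ∫ θ, cosMode m θ ∂((ρ.restrict (slab s t)).map Prod.snd + ρ' (slab s t) • spaceMeasure) =
        (∫ p in slab s t, cosMode m p.2 ∂ρ) + ρ'.real (slab s t) *
          ∫ θ in (0 : ℝ)..1, cosMode m θ := by
      intro ρ ρ' _ _ m
      have := hfin ρ'
      rw [integral_add_measure (hint _ m) (hint _ m), integral_smul_measure,
        integral_map measurable_snd.aemeasurable (continuous_cosMode m).aestronglyMeasurable,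
        intervalIntegral.integral_of_le zero_le_one, ← integral_Icc_eq_integral_Ioc]
      rfl
    have := hfin α
    have := hfin β
    refine measure_eq_of_integral_cosMode (hcar α β) (hcar β α) fun m => ?_
    rw [hval, hval]
    rcases eq_or_ne m 0 with rfl | hm
    · simp [cosMode_zero, add_comm]
    · rw [h m hm, integral_cosMode m hm]
      simp
  have hev := congrArg (fun ρ : Measure ℝ => (ρ J).toReal) hmain
  have hsmall : ∀ (ρ : Measure (ℝ × ℝ)),
      (ρ.restrict (slab s t)).map Prod.snd J = ρ (Ioc s t ×ˢ J) := by
    intro ρ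
    rw [Measure.map_apply measurable_snd hJ, Measure.restrict_apply (measurable_snd hJ)]
    congr 1
    ext p
    simp only [slab, mem_inter_iff, mem_preimage, mem_prod]
    exact ⟨fun h => ⟨h.2.1, h.1⟩, fun h => ⟨h.2, h.1, hJ1 h.2⟩⟩
  have hvol : spaceMeasure J = volume J := by
    rw [Measure.restrict_apply hJ, inter_eq_left.2 hJ1]
  have hvfin : volume J ≠ ⊤ :=
    ((measure_mono hJ1).trans_lt (by simp : volume (Icc (0 : ℝ) 1) < ⊤)).ne
  simp only [Measure.coe_add, Pi.add_apply, Measure.coe_smul, Pi.smul_apply, smul_eq_mul, hsmall,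
    hvol] at hev
  rw [ENNReal.toReal_add (measure_ne_top _ _) (ENNReal.mul_ne_top (measure_ne_top _ _) hvfin),
    ENNReal.toReal_add (measure_ne_top _ _) (ENNReal.mul_ne_top (measure_ne_top _ _) hvfin),
    ENNReal.toReal_mul, ENNReal.toReal_mul] at hev
  exact hev

/-- Two measures with the same nonconstant cosine modes on all strips are equal if, locally in
time, both vanish on a set of space points of positive length: this fixes the constant mode. -/
theorem restrict_slab_eq {α β : Measure (ℝ × ℝ)} [IsFiniteMeasure α] [IsFiniteMeasure β] {a b : ℝ}
    (h : ∀ (m : ℤ) (s t : ℝ), m ≠ 0 → a ≤ s → s ≤ t → t ≤ b →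
      ∫ p in slab s t, cosMode m p.2 ∂α = ∫ p in slab s t, cosMode m p.2 ∂β)
    (hloc : ∀ t₀ ∈ Icc a b, ∃ r > 0, ∃ J ⊆ Icc (0 : ℝ) 1, MeasurableSet J ∧ volume J ≠ 0 ∧
      α (slab a b ∩ Metric.ball t₀ r ×ˢ J) = 0 ∧ β (slab a b ∩ Metric.ball t₀ r ×ˢ J) = 0) :
    α.restrict (slab a b) = β.restrict (slab a b) := by
  choose! r hr J hJ1 hJ hJ0 hαJ hβJ using hloc
  obtain ⟨δ, hδ, hleb⟩ := lebesgue_number_lemma_of_metric (isCompact_Icc (a := a) (b := b))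
    (c := fun t₀ : Icc a b => Metric.ball (t₀ : ℝ) (r t₀)) (fun _ => Metric.isOpen_ball)
    (fun t ht => mem_iUnion.2 ⟨⟨t, ht⟩, Metric.mem_ball_self (hr t ht)⟩)
  have hadd : ∀ (μ : Measure (ℝ × ℝ)) [IsFiniteMeasure μ] {u s t : ℝ}, u ≤ s → s ≤ t →
      μ.real (slab u t) - μ.real (slab u s) = μ.real (slab s t) := by
    intro μ _ u s t hus hst
    rw [← slab_union hus hst, measureReal_union (disjoint_slab u s t) (measurableSet_slab s t)]
    ring
  have hshort : ∀ s t, a ≤ s → s ≤ t → t ≤ b → t - s < δ →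
      α.real (slab s t) = β.real (slab s t) := by
    intro s t has hst htb hlen
    obtain ⟨⟨t₀, ht₀⟩, hball⟩ := hleb s ⟨has, hst.trans htb⟩
    have hsub : Ioc s t ×ˢ J t₀ ⊆ slab a b ∩ Metric.ball t₀ (r t₀) ×ˢ J t₀ := by
      rintro p ⟨h₁, h₂⟩
      refine ⟨⟨Ioc_subset_Ioc has htb h₁, hJ1 t₀ ht₀ h₂⟩, hball ?_, h₂⟩
      rw [Metric.mem_ball, Real.dist_eq, abs_of_pos (sub_pos.2 h₁.1)]
      linarith [h₁.2]
    have hz := marginal_add_eq (fun m hm => h m s t hm has hst htb) (hJ t₀ ht₀) (hJ1 t₀ ht₀)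
    rw [measureReal_def, measure_mono_null hsub (hαJ t₀ ht₀), measureReal_def (μ := β) (s := _ ×ˢ _),
      measure_mono_null hsub (hβJ t₀ ht₀), ENNReal.toReal_zero, zero_add, zero_add] at hz
    have hv : volume.real (J t₀) ≠ 0 := by
      refine ENNReal.toReal_ne_zero.2 ⟨hJ0 t₀ ht₀, ?_⟩
      exact ((measure_mono (hJ1 t₀ ht₀)).trans_lt (by simp : volume (Icc (0 : ℝ) 1) < ⊤)).ne
    exact (mul_right_cancel₀ hv hz).symm
  have hmass : ∀ s t, a ≤ s → s ≤ t → t ≤ b → α.real (slab s t) = β.real (slab s t) := by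
    intro s t has hst htb
    have := abs_sub_le_of_forall_short (e := fun t' => α.real (slab s t') - β.real (slab s t'))
      (V := fun _ => 0) (ε := 0) hst hδ (fun u v h₁ h₂ h₃ h₄ => by
        have e₁ := hadd α h₁ h₂
        have e₂ := hadd β h₁ h₂
        have e₃ := hshort u v (has.trans h₁) h₂ (h₃.trans htb) h₄
        rw [show ∀ x y z w : ℝ, x - y - (z - w) = (x - z) - (y - w) by intros; ring, e₁, e₂, e₃]
        simp)
    simp only [sub_self, mul_zero, slab_self, measureReal_empty, sub_zero] at this
    exact sub_eq_zero.1 (abs_nonpos_iff.1 this)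
  have hrect : ∀ (s t : ℝ) {B : Set ℝ}, a ≤ s → s ≤ t → t ≤ b → MeasurableSet B → B ⊆ Icc 0 1 →
      α (Ioc s t ×ˢ B) = β (Ioc s t ×ˢ B) := by
    intro s t B has hst htb hB hB1
    have hz := marginal_add_eq (fun m hm => h m s t hm has hst htb) hB hB1
    rw [hmass s t has hst htb, add_left_inj] at hz
    exact (ENNReal.toReal_eq_toReal_iff' (measure_ne_top _ _) (measure_ne_top _ _)).1 hz
  refine Measure.ext_prod fun {S B} hS hB => ?_
  have hfst : ((α.restrict (slab a b)).restrict (univ ×ˢ B)).map Prod.fst =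
      ((β.restrict (slab a b)).restrict (univ ×ˢ B)).map Prod.fst := by
    refine Measure.ext_of_Ioc _ _ fun s t _ => ?_
    have e : ∀ μ : Measure (ℝ × ℝ),
        ((μ.restrict (slab a b)).restrict (univ ×ˢ B)).map Prod.fst (Ioc s t) =
        μ (Ioc (max s a) (min t b) ×ˢ (B ∩ Icc 0 1)) := by
      intro μ
      rw [Measure.map_apply measurable_fst measurableSet_Ioc,
        Measure.restrict_apply (measurable_fst measurableSet_Ioc),
        Measure.restrict_apply ((measurable_fst measurableSet_Ioc).inter
          (MeasurableSet.univ.prod hB))]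
      congr 1
      ext p
      simp only [slab, mem_inter_iff, mem_preimage, mem_prod, mem_univ, true_and, mem_Ioc,
        max_lt_iff, le_min_iff]
      tauto
    rw [e, e]
    rcases le_total (max s a) (min t b) with hle | hle
    · exact hrect _ _ (le_max_right _ _) hle (min_le_right _ _) (hB.inter measurableSet_Icc)
        inter_subset_right
    · simp [Ioc_eq_empty_of_le hle]
  have hev := congrArg (fun μ : Measure ℝ => μ S) hfst
  have e : ∀ μ : Measure (ℝ × ℝ),
      ((μ.restrict (slab a b)).restrict (univ ×ˢ B)).map Prod.fst S =
      μ.restrict (slab a b) (S ×ˢ B) := by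
    intro μ
    rw [Measure.map_apply measurable_fst hS, Measure.restrict_apply (measurable_fst hS)]
    congr 1
    ext p
    simp
  simp only [e] at hev
  exact hev

/-! ### Paths of solutions -/

/-- The properties of a single path of a weak solution that the uniqueness argument uses. The
field `mean_const` is the equation tested against the constant function, where the noise
vanishes. -/
structure IsReflectedPath (lam T : ℝ) (x : ℝ → ℝ) (X : ℝ → ℝ → ℝ) (ηp ηm : Measure (ℝ × ℝ)) :
    Prop where
  continuousOn : ContinuousOn (fun p : ℝ × ℝ => X p.1 p.2) (slab 0 T)
  mem_Icc : ∀ p ∈ slab 0 T, X p.1 p.2 ∈ Icc (-1 : ℝ) 1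
  tendsto_normH : Tendsto (fun s => normH fun θ => X s θ - X 0 θ) (𝓝[Icc 0 T] 0) (𝓝 0)
  initial : ∀ θ ∈ Icc (0 : ℝ) 1, X 0 θ = x θ
  carrier_plus : ∀ᵐ p ∂ηp, p ∈ slab 0 T
  carrier_minus : ∀ᵐ p ∂ηm, p ∈ slab 0 T
  finite_plus : ∀ δ ∈ Ioc 0 T, ηp (strip δ T) < ⊤
  finite_minus : ∀ δ ∈ Ioc 0 T, ηm (strip δ T) < ⊤
  f_finite : ∀ᵐ p ∂(volume.restrict (slab 0 T)),
    f lam (X p.1 p.2) ≠ ⊤ ∧ f lam (X p.1 p.2) ≠ ⊥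
  f_integrable : IntegrableOn (fun p : ℝ × ℝ => (f lam (X p.1 p.2)).toReal) (slab 0 T)
  contact_minus : ∀ᵐ p ∂ηm, X p.1 p.2 = -1
  contact_plus : ∀ᵐ p ∂ηp, X p.1 p.2 = 1
  mean_const : ∀ q : ℚ, 0 < q → q ≤ 1 → cosCoeff (X (q * T)) 0 = cosCoeff (X T) 0

/-- The noise increment over `[δ,t]` in the direction of `cosMode m`, recovered from a path of the
solution through the equation. -/
noncomputable def noiseIncrement (lam : ℝ) (X : ℝ → ℝ → ℝ) (ηp ηm : Measure (ℝ × ℝ)) (m : ℤ)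
    (δ t : ℝ) : ℝ :=
  cosCoeff (X t) m - cosCoeff (X δ) m
    + 1 / 2 * eigenvalue m ^ 2 * (∫ s in δ..t, cosCoeff (X s) m)
    - 1 / 2 * eigenvalue m * (∫ p in strip δ t, cosMode m p.2 * (f lam (X p.1 p.2)).toReal)
    - 1 / 2 * eigenvalue m *
      ((∫ p in strip δ t, cosMode m p.2 ∂ηm) - ∫ p in strip δ t, cosMode m p.2 ∂ηp)

lemma strip_subset_slab {a s t T : ℝ} (ha : 0 < a) (hs : a ≤ s) (ht : t ≤ T) :
    strip s t ⊆ slab 0 T :=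
  prod_mono (fun _ hr => ⟨ha.trans_le (hs.trans hr.1), hr.2.trans ht⟩) Subset.rfl

lemma strip_subset_strip {a s t T : ℝ} (hs : a ≤ s) (ht : t ≤ T) : strip s t ⊆ strip a T :=
  prod_mono (Icc_subset_Icc hs ht) Subset.rfl

lemma setIntegral_strip_eq {H : ℝ × ℝ → ℝ} {s t : ℝ} (hst : s ≤ t)
    (hH : IntegrableOn H (strip s t)) :
    ∫ p in strip s t, H p = ∫ r in s..t, ∫ θ in (0 : ℝ)..1, H (r, θ) := by
  unfold strip at hH ⊢
  rw [Measure.volume_eq_prod] at hH ⊢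
  rw [setIntegral_prod _ hH, intervalIntegral.integral_of_le hst, integral_Icc_eq_integral_Ioc]
  refine integral_congr_ae (ae_of_all _ fun r => ?_)
  simp only [intervalIntegral.integral_of_le zero_le_one, integral_Icc_eq_integral_Ioc]

/-- Extension of a function on `[a,T] × [0,1]` to the plane, constant in time outside `[a,T]`, and
even and `2`-periodic in space. -/
noncomputable def extend (a T : ℝ) (Y : ℝ → ℝ → ℝ) (t θ : ℝ) : ℝ :=
  Y (max a (min T t)) (fold θ)

section extend
variable {a T : ℝ} {Y : ℝ → ℝ → ℝ}

lemma clamp_mem (haT : a ≤ T) (t : ℝ) : max a (min T t) ∈ Icc a T :=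
  ⟨le_max_left _ _, max_le haT (min_le_left _ _)⟩

lemma extend_eq {t θ : ℝ} (ht : t ∈ Icc a T) (hθ : θ ∈ Icc (0 : ℝ) 1) :
    extend a T Y t θ = Y t θ := by
  rw [extend, min_eq_right ht.2, max_eq_right ht.1, fold_of_mem hθ]

lemma clamp_fold_mem_slab (ha : 0 < a) (haT : a ≤ T) (t θ : ℝ) :
    (max a (min T t), fold θ) ∈ slab 0 T :=
  ⟨⟨ha.trans_le (clamp_mem haT t).1, (clamp_mem haT t).2⟩, fold_mem θ⟩

lemma continuous_extend (ha : 0 < a) (haT : a ≤ T)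
    (hY : ContinuousOn (fun p : ℝ × ℝ => Y p.1 p.2) (slab 0 T)) :
    Continuous (Function.uncurry (extend a T Y)) := by
  have : Continuous fun p : ℝ × ℝ => (max a (min T p.1), fold p.2) := by fun_prop
  exact hY.comp_continuous this fun p => clamp_fold_mem_slab ha haT p.1 p.2

lemma cosCoeff_extend {t : ℝ} (ht : t ∈ Icc a T) (m : ℤ) :
    cosCoeff (extend a T Y t) m = cosCoeff (Y t) m :=
  cosCoeff_congr (fun _ hθ => extend_eq ht hθ) m

end extend

lemma continuousOn_cosCoeff {a T : ℝ} (ha : 0 < a) (haT : a ≤ T) {Y : ℝ → ℝ → ℝ}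
    (hY : ContinuousOn (fun p : ℝ × ℝ => Y p.1 p.2) (slab 0 T)) (m : ℤ) :
    ContinuousOn (fun t => cosCoeff (Y t) m) (Icc a T) :=
  (continuous_cosCoeff (continuous_extend ha haT hY) m).continuousOn.congr
    fun _ ht => (cosCoeff_extend ht m).symm

lemma continuousOn_slice {T : ℝ} {Y : ℝ → ℝ → ℝ}
    (hY : ContinuousOn (fun p : ℝ × ℝ => Y p.1 p.2) (slab 0 T)) {t : ℝ} (ht : t ∈ Ioc 0 T) :
    ContinuousOn (Y t) (Icc 0 1) :=
  hY.comp (f := fun θ => (t, θ)) (by fun_prop) fun _ hθ => ⟨ht, hθ⟩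

lemma cosCoeff_sub {u v : ℝ → ℝ} (hu : ContinuousOn u (Icc 0 1)) (hv : ContinuousOn v (Icc 0 1))
    (m : ℤ) : cosCoeff (fun θ => u θ - v θ) m = cosCoeff u m - cosCoeff v m := by
  unfold cosCoeff pairing
  rw [← intervalIntegral.integral_sub]
  · refine intervalIntegral.integral_congr fun θ _ => ?_
    simp only [sub_mul]
  all_goals
    refine ContinuousOn.intervalIntegrable ?_
    rw [uIcc_of_le zero_le_one]
    exact ContinuousOn.mul (by assumption) (continuous_cosMode m).continuousOn

/-! ### The norm of `H` -/

lemma pairing_eigenfunction_succ (h : ℝ → ℝ) (i : ℕ) :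
    pairing h (eigenfunction (i + 1)) = √2 * cosCoeff h ((i + 1 : ℕ) : ℤ) := by
  unfold cosCoeff pairing
  rw [← intervalIntegral.integral_const_mul]
  refine intervalIntegral.integral_congr fun θ _ => ?_
  simp only [eigenfunction, cosMode, if_neg (Nat.succ_ne_zero i)]
  push_cast
  ring

lemma pairing_eigenfunction_zero (h : ℝ → ℝ) : pairing h (eigenfunction 0) = cosCoeff h 0 := by
  simp [cosCoeff, pairing, eigenfunction, cosMode]

lemma normH_sq (h : ℝ → ℝ) : normH h ^ 2 =
    (∑' i : ℕ, (((i + 1 : ℕ) * Real.pi) ^ 2)⁻¹ * pairing h (eigenfunction (i + 1)) ^ 2) +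
      pairing h (eigenfunction 0) ^ 2 :=
  Real.sq_sqrt (add_nonneg (tsum_nonneg fun _ => by positivity) (sq_nonneg _))

lemma abs_cosCoeff_zero_le_normH (h : ℝ → ℝ) : |cosCoeff h 0| ≤ normH h := by
  rw [← pairing_eigenfunction_zero, ← Real.sqrt_sq_eq_abs]
  exact Real.sqrt_le_sqrt (le_add_of_nonneg_left (tsum_nonneg fun _ => by positivity))

lemma abs_cosCoeff_le {h : ℝ → ℝ} {C : ℝ} (hC : ∀ θ ∈ Icc (0 : ℝ) 1, |h θ| ≤ C) (m : ℤ) :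
    |cosCoeff h m| ≤ C := by
  have := intervalIntegral.norm_integral_le_of_norm_le_const (a := (0 : ℝ)) (b := 1) (C := C)
    (f := fun θ => h θ * cosMode m θ) fun θ hθ => by
      rw [uIoc_of_le zero_le_one] at hθ
      have h1 := hC θ ⟨hθ.1.le, hθ.2⟩
      rw [Real.norm_eq_abs, abs_mul]
      nlinarith [abs_cosMode_le m θ, abs_nonneg (cosMode m θ), abs_nonneg (h θ)]
  simpa [cosCoeff, pairing] using this

/-- The symmetric sums over modes `-n, …, n` of the energy are bounded by the `H`-norm. The mode
`0` does not contribute, as `eigenvalue 0 = 0` has inverse `0`. -/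
lemma sum_inv_eigenvalue_mul_le_normH_sq {h : ℝ → ℝ} {C : ℝ}
    (hC : ∀ θ ∈ Icc (0 : ℝ) 1, |h θ| ≤ C) (n : ℕ) :
    ∑ j ∈ Finset.range (2 * n + 1),
      (eigenvalue ((j : ℤ) - n))⁻¹ * cosCoeff h ((j : ℤ) - n) ^ 2 ≤ normH h ^ 2 := by
  set g : ℤ → ℝ := fun m => (eigenvalue m)⁻¹ * cosCoeff h m ^ 2 with hg
  have hneg : ∀ m, g (-m) = g m := fun m => by
    simp [hg, eigenvalue, cosCoeff, cosMode_neg]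
  have hg0 : g 0 = 0 := by simp [hg, eigenvalue_zero]
  have hsym : ∀ n : ℕ, ∑ j ∈ Finset.range (2 * n + 1), g ((j : ℤ) - n) =
      2 * ∑ i ∈ Finset.range n, g ((i + 1 : ℕ) : ℤ) := by
    intro n
    rw [show 2 * n + 1 = n + (n + 1) by ring, Finset.sum_range_add, ← Finset.sum_range_reflect,
      Finset.sum_range_succ' _ n]
    simp only [add_zero, sub_self, hg0, two_mul]
    congr 1
    · refine Finset.sum_congr rfl fun i hi => ?_
      have hi' := Finset.mem_range.1 hi
      rw [← hneg]
      congr 1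
      omega
    · refine Finset.sum_congr rfl fun i hi => ?_
      congr 1
      push_cast
      ring
  have hterm : ∀ i : ℕ, 2 * g ((i + 1 : ℕ) : ℤ) =
      (((i + 1 : ℕ) * Real.pi) ^ 2)⁻¹ * pairing h (eigenfunction (i + 1)) ^ 2 := by
    intro i
    rw [pairing_eigenfunction_succ, mul_pow √2, Real.sq_sqrt zero_le_two]
    simp only [hg, eigenvalue]
    push_cast
    ring
  have hsummable : Summable fun i : ℕ =>
      (((i + 1 : ℕ) * Real.pi) ^ 2)⁻¹ * pairing h (eigenfunction (i + 1)) ^ 2 := by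
    have hs : Summable fun i : ℕ => ((2 * C ^ 2) * (Real.pi ^ 2)⁻¹) * (((i + 1 : ℕ) : ℝ) ^ 2)⁻¹ :=
      ((summable_nat_add_iff 1).2 (Real.summable_nat_pow_inv.2 one_lt_two)).mul_left _
    refine hs.of_nonneg_of_le (fun i => by positivity) fun i => ?_
    have hb : cosCoeff h ((i + 1 : ℕ) : ℤ) ^ 2 ≤ C ^ 2 := by
      rw [← sq_abs]
      exact pow_le_pow_left₀ (abs_nonneg _) (abs_cosCoeff_le hC _) 2
    rw [pairing_eigenfunction_succ, mul_pow √2, Real.sq_sqrt zero_le_two, mul_pow, mul_inv]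
    calc _ = (2 * (Real.pi ^ 2)⁻¹ * (((i + 1 : ℕ) : ℝ) ^ 2)⁻¹) *
          cosCoeff h ((i + 1 : ℕ) : ℤ) ^ 2 := by ring
      _ ≤ (2 * (Real.pi ^ 2)⁻¹ * (((i + 1 : ℕ) : ℝ) ^ 2)⁻¹) * C ^ 2 := by gcongr
      _ = _ := by ring
  rw [hsym n, normH_sq, Finset.mul_sum]
  simp only [hterm]
  exact (hsummable.sum_le_tsum _ fun i _ => by positivity).trans
    (le_add_of_nonneg_right (sq_nonneg _))

/-! ### The forces acting on the difference of two solutions -/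

/-- The difference of the logarithmic parts of `f` at `X₁` and `X₂`; it is opposite in sign to
`X₁ - X₂`. -/
noncomputable def logGap (lam : ℝ) (X₁ X₂ : ℝ → ℝ → ℝ) (p : ℝ × ℝ) : ℝ :=
  (f lam (X₁ p.1 p.2)).toReal - (f lam (X₂ p.1 p.2)).toReal - lam * (X₁ p.1 p.2 - X₂ p.1 p.2)

lemma logGap_swap (lam : ℝ) (X₁ X₂ : ℝ → ℝ → ℝ) (p : ℝ × ℝ) :
    logGap lam X₂ X₁ p = -logGap lam X₁ X₂ p := by
  unfold logGap; ring

lemma mem_Ioo_of_f_finite {lam u : ℝ} (h : f lam u ≠ ⊤ ∧ f lam u ≠ ⊥) : -1 < u ∧ u < 1 := by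
  unfold f at h
  split_ifs at h with h₁ h₂
  · exact absurd rfl h.1
  · exact absurd rfl h.2
  · exact ⟨not_le.1 h₁, not_le.1 h₂⟩

lemma f_toReal {lam u : ℝ} (h₁ : -1 < u) (h₂ : u < 1) :
    (f lam u).toReal = Real.log ((1 - u) / (1 + u)) + lam * u := by
  rw [f, if_neg (not_le.2 h₁), if_neg (not_le.2 h₂), EReal.toReal_coe]

lemma logGap_neg_of_lt {lam : ℝ} {X₁ X₂ : ℝ → ℝ → ℝ} {p : ℝ × ℝ}
    (h₁ : f lam (X₁ p.1 p.2) ≠ ⊤ ∧ f lam (X₁ p.1 p.2) ≠ ⊥)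
    (h₂ : f lam (X₂ p.1 p.2) ≠ ⊤ ∧ f lam (X₂ p.1 p.2) ≠ ⊥)
    (hlt : X₂ p.1 p.2 < X₁ p.1 p.2) : logGap lam X₁ X₂ p < 0 := by
  obtain ⟨a₁, b₁⟩ := mem_Ioo_of_f_finite h₁
  obtain ⟨a₂, b₂⟩ := mem_Ioo_of_f_finite h₂
  rw [logGap, f_toReal a₁ b₁, f_toReal a₂ b₂]
  have : Real.log ((1 - X₁ p.1 p.2) / (1 + X₁ p.1 p.2)) <
      Real.log ((1 - X₂ p.1 p.2) / (1 + X₂ p.1 p.2)) := by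
    refine Real.log_lt_log (div_pos (by linarith) (by linarith)) ?_
    rw [div_lt_div_iff₀ (by linarith) (by linarith)]
    nlinarith
  linarith

/-- The measure that pushes `X₁ - X₂` upwards: the reflections of `X₁` at `-1` and of `X₂` at `1`,
and the positive part of the difference of the logarithmic terms. -/
noncomputable def upForce (lam T : ℝ) (X₁ X₂ : ℝ → ℝ → ℝ) (ηm₁ ηp₂ : Measure (ℝ × ℝ)) :
    Measure (ℝ × ℝ) :=
  ηm₁ + ηp₂ +
    (volume.restrict (slab 0 T)).withDensity fun p => ENNReal.ofReal (logGap lam X₁ X₂ p)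

section forces
variable {lam T : ℝ} {x : ℝ → ℝ} {X₁ X₂ : ℝ → ℝ → ℝ} {ηp₁ ηm₁ ηp₂ ηm₂ : Measure (ℝ × ℝ)}

lemma IsReflectedPath.integrableOn (h : IsReflectedPath lam T x X₁ ηp₁ ηm₁) :
    IntegrableOn (fun p : ℝ × ℝ => X₁ p.1 p.2) (slab 0 T) := by
  have hfin : IsFiniteMeasure (volume.restrict (slab 0 T)) :=
    ⟨by
      rw [Measure.restrict_apply_univ]
      exact (measure_mono (slab_subset_strip 0 T)).trans_lt
        (isCompact_Icc.prod isCompact_Icc).measure_lt_top⟩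
  refine Integrable.of_bound (h.continuousOn.aestronglyMeasurable (measurableSet_slab 0 T)) 1 ?_
  filter_upwards [ae_restrict_mem (measurableSet_slab 0 T)] with p hp
  exact abs_le.2 (h.mem_Icc p hp)

lemma integrableOn_logGap (h₁ : IsReflectedPath lam T x X₁ ηp₁ ηm₁)
    (h₂ : IsReflectedPath lam T x X₂ ηp₂ ηm₂) : IntegrableOn (logGap lam X₁ X₂) (slab 0 T) :=
  (h₁.f_integrable.sub h₂.f_integrable).sub ((h₁.integrableOn.sub h₂.integrableOn).const_mul lam)

lemma ae_upForce_le (h₁ : IsReflectedPath lam T x X₁ ηp₁ ηm₁)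
    (h₂ : IsReflectedPath lam T x X₂ ηp₂ ηm₂) :
    ∀ᵐ p ∂upForce lam T X₁ X₂ ηm₁ ηp₂, X₁ p.1 p.2 ≤ X₂ p.1 p.2 := by
  rw [upForce, ae_add_measure_iff, ae_add_measure_iff]
  refine ⟨⟨?_, ?_⟩, ?_⟩
  · filter_upwards [h₁.contact_minus, h₁.carrier_minus] with p hp hp'
    rw [hp]
    exact (h₂.mem_Icc p hp').1
  · filter_upwards [h₂.contact_plus, h₂.carrier_plus] with p hp hp'
    rw [hp]
    exact (h₁.mem_Icc p hp').2
  · rw [ae_withDensity_iff' (integrableOn_logGap h₁ h₂).aemeasurable.ennreal_ofReal]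
    filter_upwards [h₁.f_finite, h₂.f_finite] with p hp₁ hp₂ hne
    by_contra! hlt
    exact hne (ENNReal.ofReal_eq_zero.2 (logGap_neg_of_lt hp₁ hp₂ hlt).le)

lemma upForce_strip_lt_top (h₁ : IsReflectedPath lam T x X₁ ηp₁ ηm₁)
    (h₂ : IsReflectedPath lam T x X₂ ηp₂ ηm₂) {a : ℝ} (ha : a ∈ Ioc 0 T) :
    upForce lam T X₁ X₂ ηm₁ ηp₂ (strip a T) < ⊤ := by
  simp only [upForce, Measure.coe_add, Pi.add_apply]
  refine ENNReal.add_lt_top.2 ⟨ENNReal.add_lt_top.2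
    ⟨h₁.finite_minus a ha, h₂.finite_plus a ha⟩, ?_⟩
  have : IsFiniteMeasure ((volume.restrict (slab 0 T)).withDensity
      fun p => ENNReal.ofReal (logGap lam X₁ X₂ p)) :=
    isFiniteMeasure_withDensity_ofReal (integrableOn_logGap h₁ h₂).2
  exact measure_lt_top _ _

lemma setIntegral_upForce (h₁ : IsReflectedPath lam T x X₁ ηp₁ ηm₁)
    (h₂ : IsReflectedPath lam T x X₂ ηp₂ ηm₂) {a s t : ℝ} (ha : 0 < a) (hs : a ≤ s) (hst : s ≤ t)
    (ht : t ≤ T) (m : ℤ) :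
    ∫ p in strip s t, cosMode m p.2 ∂upForce lam T X₁ X₂ ηm₁ ηp₂ =
      (∫ p in strip s t, cosMode m p.2 ∂ηm₁) + (∫ p in strip s t, cosMode m p.2 ∂ηp₂) +
      ∫ p in strip s t, max (logGap lam X₁ X₂ p) 0 * cosMode m p.2 := by
  have haT : a ∈ Ioc 0 T := ⟨ha, hs.trans (hst.trans ht)⟩
  have hsub := strip_subset_strip hs ht
  have hint : ∀ μ : Measure (ℝ × ℝ), μ (strip a T) < ⊤ →
      Integrable (fun p : ℝ × ℝ => cosMode m p.2) (μ.restrict (strip s t)) := by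
    intro μ hμ
    have : IsFiniteMeasure (μ.restrict (strip s t)) :=
      ⟨by rw [Measure.restrict_apply_univ]; exact (measure_mono hsub).trans_lt hμ⟩
    exact Integrable.of_bound ((continuous_cosMode m).comp continuous_snd).aestronglyMeasurable 1
      (ae_of_all _ fun p => abs_cosMode_le m p.2)
  have hU := upForce_strip_lt_top h₁ h₂ haT
  have hmono : ∀ μ : Measure (ℝ × ℝ), μ ≤ upForce lam T X₁ X₂ ηm₁ ηp₂ → μ (strip a T) < ⊤ :=
    fun μ hμ => (hμ _).trans_lt hU
  have hGm : AEMeasurable (fun p => ENNReal.ofReal (logGap lam X₁ X₂ p))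
      (volume.restrict (strip s t)) :=
    ((integrableOn_logGap h₁ h₂).mono_set
      (strip_subset_slab ha hs ht)).aemeasurable.ennreal_ofReal
  have hi₁ := hint ηm₁ (h₁.finite_minus a haT)
  have hi₂ := hint ηp₂ (h₂.finite_plus a haT)
  have hi₃ := hint _ (hmono ((volume.restrict (slab 0 T)).withDensity
    fun p => ENNReal.ofReal (logGap lam X₁ X₂ p)) (Measure.le_add_left le_rfl))
  rw [upForce, Measure.restrict_add, Measure.restrict_add,
    integral_add_measure (hi₁.add_measure hi₂) hi₃, integral_add_measure hi₁ hi₂,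
    restrict_withDensity (measurableSet_strip s t),
    Measure.restrict_restrict (measurableSet_strip s t),
    inter_eq_left.2 (strip_subset_slab ha hs ht),
    integral_withDensity_eq_integral_toReal_smul₀ hGm (ae_of_all _ fun _ => ENNReal.ofReal_lt_top)]
  simp only [ENNReal.toReal_ofReal', smul_eq_mul]

end forces

/-! ### The equation for the difference of two solutions -/

lemma tendsto_setIntegral_slab {μ : Measure (ℝ × ℝ)} {φ : ℝ × ℝ → ℝ} {a t T : ℝ} (htT : t < T) (hφ : IntegrableOn φ (slab a T) μ) :
    Tendsto (fun s => ∫ p in slab a s, φ p ∂μ) (𝓝[>] t) (𝓝 (∫ p in slab a t, φ p ∂μ)) := by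
  simp only [← integral_indicator (measurableSet_slab a _)]
  have hev : ∀ᶠ s in 𝓝[>] t, s < T := mem_nhdsWithin_of_mem_nhds (Iio_mem_nhds htT)
  refine tendsto_integral_filter_of_dominated_convergence
    (fun p => ‖(slab a T).indicator φ p‖) ?_ ?_
    (hφ.integrable_indicator (measurableSet_slab a T)).norm (ae_of_all _ fun p => ?_)
  · filter_upwards [hev] with s hs
    exact ((hφ.mono_set (slab_mono le_rfl hs.le)).integrable_indicator
      (measurableSet_slab a s)).aestronglyMeasurable
  · filter_upwards [hev] with s hs
    exact ae_of_all _ fun p =>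
      norm_indicator_le_of_subset (slab_mono le_rfl hs.le) φ p
  · refine tendsto_const_nhds.congr' ?_
    rcases le_or_gt p.1 t with hp | hp
    · filter_upwards [self_mem_nhdsWithin] with s hs
      have hiff : p ∈ slab a t ↔ p ∈ slab a s :=
        ⟨fun h => slab_mono le_rfl (mem_Ioi.1 hs).le h, fun h => ⟨⟨h.1.1, hp⟩, h.2⟩⟩
      by_cases h : p ∈ slab a t
      · rw [indicator_of_mem h, indicator_of_mem (hiff.1 h)]
      · rw [indicator_of_notMem h, indicator_of_notMem (mt hiff.2 h)]
    · filter_upwards [mem_nhdsWithin_of_mem_nhds (Iio_mem_nhds hp)] with s hs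
      rw [indicator_of_notMem fun h => absurd h.1.2 (not_le.2 hp),
        indicator_of_notMem fun h => absurd h.1.2 (not_le.2 hs)]

/-- Two paths are driven by the same noise, at rational multiples of the final time. -/
def SameNoise (lam T : ℝ) (X₁ : ℝ → ℝ → ℝ) (ηp₁ ηm₁ : Measure (ℝ × ℝ)) (X₂ : ℝ → ℝ → ℝ)
    (ηp₂ ηm₂ : Measure (ℝ × ℝ)) : Prop :=
  ∀ (m : ℤ) (q r : ℚ), 0 < q → q ≤ r → r ≤ 1 →
    noiseIncrement lam X₁ ηp₁ ηm₁ m (q * T) (r * T) =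
      noiseIncrement lam X₂ ηp₂ ηm₂ m (q * T) (r * T)

section difference
variable {lam T : ℝ} {x : ℝ → ℝ} {X₁ X₂ : ℝ → ℝ → ℝ} {ηp₁ ηm₁ ηp₂ ηm₂ : Measure (ℝ × ℝ)}

lemma setIntegral_f_sub (h₁ : IsReflectedPath lam T x X₁ ηp₁ ηm₁)
    (h₂ : IsReflectedPath lam T x X₂ ηp₂ ηm₂) {a t : ℝ} (ha : 0 < a) (hat : a ≤ t)
    (ht : t ≤ T) (m : ℤ) :
    (∫ p in strip a t, cosMode m p.2 * (f lam (X₁ p.1 p.2)).toReal) -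
      (∫ p in strip a t, cosMode m p.2 * (f lam (X₂ p.1 p.2)).toReal) =
    ((∫ p in strip a t, max (logGap lam X₁ X₂ p) 0 * cosMode m p.2) -
      ∫ p in strip a t, max (logGap lam X₂ X₁ p) 0 * cosMode m p.2) +
    lam * ∫ r in a..t, (cosCoeff (X₁ r) m - cosCoeff (X₂ r) m) := by
  have hsub : strip a t ⊆ slab 0 T := strip_subset_slab ha le_rfl ht
  have hcm : ∀ μ : Measure (ℝ × ℝ), AEStronglyMeasurable (fun p : ℝ × ℝ => cosMode m p.2) μ :=
    fun μ => ((continuous_cosMode m).comp continuous_snd).aestronglyMeasurable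
  have hcb : ∀ μ : Measure (ℝ × ℝ), ∀ᵐ p ∂μ, ‖cosMode m p.2‖ ≤ 1 :=
    fun μ => ae_of_all _ fun p => abs_cosMode_le m p.2
  have if₁ := (h₁.f_integrable.mono_set hsub).bdd_mul (hcm _) (hcb _)
  have if₂ := (h₂.f_integrable.mono_set hsub).bdd_mul (hcm _) (hcb _)
  have ig₁ := ((integrableOn_logGap h₁ h₂).mono_set hsub).pos_part.mul_bdd (hcm _) (hcb _)
  have ig₂ := ((integrableOn_logGap h₂ h₁).mono_set hsub).pos_part.mul_bdd (hcm _) (hcb _)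
  have iX : IntegrableOn (fun p : ℝ × ℝ => (X₁ p.1 p.2 - X₂ p.1 p.2) * cosMode m p.2)
      (strip a t) :=
    ((h₁.integrableOn.mono_set hsub).sub (h₂.integrableOn.mono_set hsub)).mul_bdd (hcm _) (hcb _)
  have hy : ∫ r in a..t, (cosCoeff (X₁ r) m - cosCoeff (X₂ r) m) =
      ∫ p in strip a t, (X₁ p.1 p.2 - X₂ p.1 p.2) * cosMode m p.2 := by
    rw [setIntegral_strip_eq hat iX]
    refine intervalIntegral.integral_congr fun r hr => ?_
    rw [uIcc_of_le hat] at hr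
    have hr' : r ∈ Ioc 0 T := ⟨ha.trans_le hr.1, hr.2.trans ht⟩
    exact (cosCoeff_sub (continuousOn_slice h₁.continuousOn hr')
      (continuousOn_slice h₂.continuousOn hr') m).symm
  have ig : Integrable (fun p : ℝ × ℝ => max (logGap lam X₁ X₂ p) 0 * cosMode m p.2 -
      max (logGap lam X₂ X₁ p) 0 * cosMode m p.2) (volume.restrict (strip a t)) := ig₁.sub ig₂
  rw [hy, ← integral_sub if₁ if₂, ← integral_sub ig₁ ig₂, ← integral_const_mul,
    ← integral_add ig (iX.const_mul lam)]
  refine integral_congr_ae (ae_of_all _ fun p => ?_)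
  simp only [logGap_swap lam X₁ X₂ p]
  have hmax : max (logGap lam X₁ X₂ p) 0 - max (-logGap lam X₁ X₂ p) 0 = logGap lam X₁ X₂ p :=
    max_zero_sub_max_neg_zero_eq_self _
  have hG : logGap lam X₁ X₂ p = (f lam (X₁ p.1 p.2)).toReal - (f lam (X₂ p.1 p.2)).toReal -
    lam * (X₁ p.1 p.2 - X₂ p.1 p.2) := rfl
  linear_combination -cosMode m p.2 * hmax - cosMode m p.2 * hG

lemma increment_of_rat (h₁ : IsReflectedPath lam T x X₁ ηp₁ ηm₁)
    (h₂ : IsReflectedPath lam T x X₂ ηp₂ ηm₂)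
    (hN : SameNoise lam T X₁ ηp₁ ηm₁ X₂ ηp₂ ηm₂) (hT : 0 < T) (m : ℤ) {q r : ℚ} (hq : 0 < q)
    (hqr : q ≤ r) (hr : r ≤ 1) :
    (cosCoeff (X₁ (r * T)) m - cosCoeff (X₂ (r * T)) m) -
      (cosCoeff (X₁ (q * T)) m - cosCoeff (X₂ (q * T)) m) =
    1 / 2 * (lam * eigenvalue m - eigenvalue m ^ 2) *
      (∫ s in (q * T : ℝ)..(r * T), (cosCoeff (X₁ s) m - cosCoeff (X₂ s) m)) +
    1 / 2 * eigenvalue m *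
      ((∫ p in strip (q * T) (r * T), cosMode m p.2 ∂upForce lam T X₁ X₂ ηm₁ ηp₂) -
        ∫ p in strip (q * T) (r * T), cosMode m p.2 ∂upForce lam T X₂ X₁ ηm₂ ηp₁) := by
  have ha : 0 < (q : ℝ) * T := mul_pos (by exact_mod_cast hq) hT
  have hat : (q : ℝ) * T ≤ r * T := mul_le_mul_of_nonneg_right (by exact_mod_cast hqr) hT.le
  have htT : (r : ℝ) * T ≤ T := mul_le_of_le_one_left hT.le (by exact_mod_cast hr)
  have hn := hN m q r hq hqr hr
  rw [setIntegral_upForce h₁ h₂ ha le_rfl hat htT, setIntegral_upForce h₂ h₁ ha le_rfl hat htT]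
  have hf := setIntegral_f_sub h₁ h₂ ha hat htT m
  have hsub : Icc (q * T : ℝ) (r * T) ⊆ Icc (q * T) T := Icc_subset_Icc_right htT
  have hi : ∀ {X : ℝ → ℝ → ℝ}, ContinuousOn (fun p : ℝ × ℝ => X p.1 p.2) (slab 0 T) →
      IntervalIntegrable (fun s => cosCoeff (X s) m) volume (q * T) (r * T) := fun hX =>
    ContinuousOn.intervalIntegrable (by
      rw [uIcc_of_le hat]
      exact (continuousOn_cosCoeff ha (hat.trans htT) hX m).mono hsub)
  rw [intervalIntegral.integral_sub (hi h₁.continuousOn) (hi h₂.continuousOn)] at hf ⊢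
  unfold noiseIncrement at hn
  linear_combination hn + 1 / 2 * eigenvalue m * hf

lemma isFiniteMeasure_restrict_upForce (h₁ : IsReflectedPath lam T x X₁ ηp₁ ηm₁)
    (h₂ : IsReflectedPath lam T x X₂ ηp₂ ηm₂) {a : ℝ} (ha : a ∈ Ioc 0 T) :
    IsFiniteMeasure ((upForce lam T X₁ X₂ ηm₁ ηp₂).restrict (strip a T)) :=
  ⟨by rw [Measure.restrict_apply_univ]; exact upForce_strip_lt_top h₁ h₂ ha⟩

/-- The equation for the difference of two solutions holds between all times, by right-continuity
in the final time. At equal times it shows that time atoms of the forces only have a constant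
mode; hence strips may be taken open on the left. -/
lemma increment_extend (h₁ : IsReflectedPath lam T x X₁ ηp₁ ηm₁)
    (h₂ : IsReflectedPath lam T x X₂ ηp₂ ηm₂)
    (hN : SameNoise lam T X₁ ηp₁ ηm₁ X₂ ηp₂ ηm₂) (hT : 0 < T) (m : ℤ) {q : ℚ} (hq : 0 < q)
    (hq1 : q ≤ 1) {Z : ℝ → ℝ → ℝ} (hZ : Z = extend (q * T) T fun t θ => X₁ t θ - X₂ t θ)
    {α β : Measure (ℝ × ℝ)}
    (hα : α = (upForce lam T X₁ X₂ ηm₁ ηp₂).restrict (strip (q * T) T))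
    (hβ : β = (upForce lam T X₂ X₁ ηm₂ ηp₁).restrict (strip (q * T) T))
    {s t : ℝ} (hs : q * T ≤ s) (hst : s ≤ t) (ht : t ≤ T) :
    cosCoeff (Z t) m - cosCoeff (Z s) m =
      (∫ r in s..t, 1 / 2 * (lam * eigenvalue m - eigenvalue m ^ 2) * cosCoeff (Z r) m) +
      1 / 2 * eigenvalue m *
        ((∫ p in slab s t, cosMode m p.2 ∂α) - ∫ p in slab s t, cosMode m p.2 ∂β) := by
  set a : ℝ := q * T with ha_def
  have ha : 0 < a := mul_pos (by exact_mod_cast hq) hT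
  have haT : a ≤ T := mul_le_of_le_one_left hT.le (by exact_mod_cast hq1)
  have : IsFiniteMeasure α := hα ▸ isFiniteMeasure_restrict_upForce h₁ h₂ ⟨ha, haT⟩
  have : IsFiniteMeasure β := hβ ▸ isFiniteMeasure_restrict_upForce h₂ h₁ ⟨ha, haT⟩
  have hYc : ContinuousOn (fun p : ℝ × ℝ => X₁ p.1 p.2 - X₂ p.1 p.2) (slab 0 T) :=
    h₁.continuousOn.sub h₂.continuousOn
  have hZc : Continuous fun t => cosCoeff (Z t) m := by
    rw [hZ]
    exact continuous_cosCoeff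
      (continuous_extend (Y := fun t θ => X₁ t θ - X₂ t θ) ha haT hYc) m
  have hZeq : ∀ t ∈ Icc a T, cosCoeff (Z t) m = cosCoeff (X₁ t) m - cosCoeff (X₂ t) m := by
    intro t ht
    have ht' : t ∈ Ioc 0 T := ⟨ha.trans_le ht.1, ht.2⟩
    rw [hZ, cosCoeff_extend ht, cosCoeff_sub (continuousOn_slice h₁.continuousOn ht')
      (continuousOn_slice h₂.continuousOn ht')]
  have hci : ∀ (μ : Measure (ℝ × ℝ)) [IsFiniteMeasure μ] (A : Set (ℝ × ℝ)),
      IntegrableOn (fun p : ℝ × ℝ => cosMode m p.2) A μ := fun μ _ A =>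
    Integrable.of_bound ((continuous_cosMode m).comp continuous_snd).aestronglyMeasurable 1
      (ae_of_all _ fun p => abs_cosMode_le m p.2)
  set κ : ℝ := 1 / 2 * (lam * eigenvalue m - eigenvalue m ^ 2) with hκ
  set E : ℝ → ℝ := fun t => cosCoeff (Z t) m - (∫ r in a..t, κ * cosCoeff (Z r) m) -
    1 / 2 * eigenvalue m *
      ((∫ p in slab a t, cosMode m p.2 ∂α) - ∫ p in slab a t, cosMode m p.2 ∂β) with hE
  have hrestr : ∀ (μ : Measure (ℝ × ℝ)) {t : ℝ}, t ≤ T →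
      ∫ p in strip a t, cosMode m p.2 ∂(μ.restrict (strip a T)) =
      ∫ p in strip a t, cosMode m p.2 ∂μ := fun μ t ht => by
    rw [Measure.restrict_restrict (measurableSet_strip a t),
      inter_eq_left.2 (strip_subset_strip le_rfl ht)]
  have hsplit : ∀ (μ : Measure (ℝ × ℝ)) [IsFiniteMeasure μ] {t : ℝ}, a ≤ t →
      ∫ p in strip a t, cosMode m p.2 ∂μ =
      (∫ p in strip a a, cosMode m p.2 ∂μ) + ∫ p in slab a t, cosMode m p.2 ∂μ := by
    intro μ _ t hat
    have hu : strip a t = strip a a ∪ slab a t := by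
      rw [strip, strip, slab, ← union_prod, Icc_self, union_comm, Ioc_union_left hat]
    have hd : Disjoint (strip a a) (slab a t) := by
      refine Disjoint.set_prod_left ?_ _ _
      simp
    rw [hu, setIntegral_union hd (measurableSet_slab a t) (hci μ _) (hci μ _)]
  have hrat : ∀ r : ℚ, q ≤ r → r ≤ 1 → E (r * T) = cosCoeff (Z a) m := by
    intro r hqr hr
    have hat : a ≤ r * T := mul_le_mul_of_nonneg_right (by exact_mod_cast hqr) hT.le
    have htT : (r : ℝ) * T ≤ T := mul_le_of_le_one_left hT.le (by exact_mod_cast hr)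
    have e₀ := increment_of_rat h₁ h₂ hN hT m hq le_rfl hq1
    have e₁ := increment_of_rat h₁ h₂ hN hT m hq hqr hr
    have e₂ : ∫ s in a..(r * T), (cosCoeff (X₁ s) m - cosCoeff (X₂ s) m) =
        ∫ s in a..(r * T), cosCoeff (Z s) m :=
      intervalIntegral.integral_congr fun s hs => by
        rw [uIcc_of_le hat] at hs
        exact (hZeq s ⟨hs.1, hs.2.trans htT⟩).symm
    rw [← ha_def] at e₀ e₁
    rw [sub_self, intervalIntegral.integral_same, ← hrestr _ haT, ← hrestr (upForce _ _ _ _ _ _) haT,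
      ← hα, ← hβ] at e₀
    rw [← hZeq _ ⟨hat, htT⟩, ← hZeq a ⟨le_rfl, haT⟩, e₂, ← hrestr _ htT,
      ← hrestr (upForce _ _ _ _ _ _) htT, ← hα, ← hβ, hsplit α hat, hsplit β hat] at e₁
    simp only [hE, intervalIntegral.integral_const_mul]
    linear_combination e₁ - e₀
  have hE_eq : ∀ t, a ≤ t → t ≤ T → E t = cosCoeff (Z a) m := by
    intro t hat htT
    rcases htT.eq_or_lt with rfl | htT
    · simpa using hrat 1 hq1 le_rfl
    have hlim : Tendsto E (𝓝[>] t) (𝓝 (E t)) := by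
      have hcont : Continuous fun t => cosCoeff (Z t) m - ∫ r in a..t, κ * cosCoeff (Z r) m :=
        hZc.sub (intervalIntegral.continuous_primitive
          (fun _ _ => (continuous_const.mul hZc).intervalIntegrable _ _) a)
      exact ((hcont.tendsto t).mono_left nhdsWithin_le_nhds).sub
        (((tendsto_setIntegral_slab htT (hci α _)).sub
          (tendsto_setIntegral_slab htT (hci β _))).const_mul _)
    by_contra hne
    have hev := (hlim.eventually_ne hne).and (mem_nhdsWithin_of_mem_nhds (Iio_mem_nhds htT))
    obtain ⟨u, htu, hu⟩ := (mem_nhdsGT_iff_exists_Ioo_subset).1 hev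
    obtain ⟨r, hr₁, hr₂⟩ := exists_rat_btwn ((div_lt_div_iff_of_pos_right hT).2 htu)
    rw [div_lt_iff₀ hT] at hr₁
    rw [lt_div_iff₀ hT] at hr₂
    obtain ⟨hr₃, hr₄⟩ := hu ⟨hr₁, hr₂⟩
    refine hr₃ (hrat r ?_ ?_)
    · have : (q : ℝ) * T < r * T := hat.trans_lt hr₁
      exact_mod_cast (lt_of_mul_lt_mul_right this hT.le).le
    · have : (r : ℝ) * T < 1 * T := by rw [one_mul]; exact hr₄
      exact_mod_cast (lt_of_mul_lt_mul_right this hT.le).le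
  have hκZ : Continuous fun r => κ * cosCoeff (Z r) m := continuous_const.mul hZc
  have hEt := hE_eq t (hs.trans hst) ht
  have hEs := hE_eq s hs (hst.trans ht)
  rw [← setIntegral_slab_sub (hci α _) hs hst, ← setIntegral_slab_sub (hci β _) hs hst,
    ← intervalIntegral.integral_interval_sub_left
      (hκZ.intervalIntegrable a t) (hκZ.intervalIntegrable a s)]
  simp only [hE] at hEt hEs
  linear_combination hEt - hEs

end difference

/-! ### Uniqueness of the path -/

lemma cosCoeff_neg (g : ℝ → ℝ) (m : ℤ) : cosCoeff g (-m) = cosCoeff g m := by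
  rw [cosCoeff, cosMode_neg, cosCoeff]

/-- The rational times `T / (n + 1)`, at which the equation is started, decrease to `0`. -/
lemma tendsto_startTime {T : ℝ} (hT : 0 < T) :
    Tendsto (fun n : ℕ => ((1 / (n + 1) : ℚ) : ℝ) * T) atTop (𝓝[Icc 0 T] 0) := by
  refine tendsto_nhdsWithin_iff.2 ⟨?_, Eventually.of_forall fun n => ?_⟩
  · have := (tendsto_one_div_add_atTop_nhds_zero_nat (𝕜 := ℝ)).mul_const T
    rw [zero_mul] at this
    refine this.congr fun n => ?_
    push_cast
    rfl
  · push_cast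
    have h1 : (0 : ℝ) < 1 / (n + 1) := Nat.one_div_pos_of_nat
    have h2 : (1 : ℝ) / (n + 1) ≤ 1 := by
      rw [div_le_one (by positivity)]
      linarith [n.cast_nonneg (α := ℝ)]
    exact ⟨by positivity, mul_le_of_le_one_left hT.le h2⟩

lemma startTime_rat (n : ℕ) : (0 : ℚ) < 1 / (n + 1) ∧ (1 / (n + 1) : ℚ) ≤ 1 := by
  refine ⟨Nat.one_div_pos_of_nat, ?_⟩
  rw [div_le_one (by positivity)]
  linarith [n.cast_nonneg (α := ℚ)]

lemma startTime_mem {T : ℝ} (hT : 0 < T) {q : ℚ} (hq : 0 < q) (hq1 : q ≤ 1) :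
    (q : ℝ) * T ∈ Ioc 0 T :=
  ⟨mul_pos (by exact_mod_cast hq) hT, mul_le_of_le_one_left hT.le (by exact_mod_cast hq1)⟩

section difference
variable {lam T : ℝ} {x : ℝ → ℝ} {X₁ X₂ : ℝ → ℝ → ℝ} {ηp₁ ηm₁ ηp₂ ηm₂ : Measure (ℝ × ℝ)}

lemma cosCoeff_sub_eq_initial (hx : ContinuousOn x (Icc 0 1))
    (h₁ : IsReflectedPath lam T x X₁ ηp₁ ηm₁) (h₂ : IsReflectedPath lam T x X₂ ηp₂ ηm₂)
    {t : ℝ} (ht : t ∈ Ioc 0 T) (m : ℤ) :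
    cosCoeff (X₁ t) m - cosCoeff (X₂ t) m =
      cosCoeff (fun θ => X₁ t θ - X₁ 0 θ) m - cosCoeff (fun θ => X₂ t θ - X₂ 0 θ) m := by
  rw [cosCoeff_sub (continuousOn_slice h₁.continuousOn ht) (hx.congr h₁.initial),
    cosCoeff_sub (continuousOn_slice h₂.continuousOn ht) (hx.congr h₂.initial),
    cosCoeff_congr (fun θ hθ => (h₁.initial θ hθ).trans (h₂.initial θ hθ).symm) m]
  ring

lemma IsReflectedPath.abs_sub_initial_le (hx' : ∀ θ ∈ Icc (0 : ℝ) 1, x θ ∈ Icc (-1 : ℝ) 1)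
    (h : IsReflectedPath lam T x X₁ ηp₁ ηm₁) {t : ℝ} (ht : t ∈ Ioc 0 T) :
    ∀ θ ∈ Icc (0 : ℝ) 1, |X₁ t θ - X₁ 0 θ| ≤ 2 := by
  intro θ hθ
  have := h.mem_Icc (t, θ) ⟨ht, hθ⟩
  have := hx' θ hθ
  rw [h.initial θ hθ, abs_le]
  simp only [Set.mem_Icc] at *
  constructor <;> linarith

/-- Two solutions have the same mean at the start times, because they have the same initial value
and paths continuous in `H`. -/
lemma mean_eq (hT : 0 < T) (hx : ContinuousOn x (Icc 0 1))
    (h₁ : IsReflectedPath lam T x X₁ ηp₁ ηm₁) (h₂ : IsReflectedPath lam T x X₂ ηp₂ ηm₂)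
    {q : ℚ} (hq : 0 < q) (hq1 : q ≤ 1) :
    cosCoeff (X₁ (q * T)) 0 - cosCoeff (X₂ (q * T)) 0 = 0 := by
  rw [h₁.mean_const q hq hq1, h₂.mean_const q hq hq1, ← abs_nonpos_iff]
  have hlim := (h₁.tendsto_normH.comp (tendsto_startTime hT)).add
    (h₂.tendsto_normH.comp (tendsto_startTime hT))
  rw [add_zero] at hlim
  refine ge_of_tendsto hlim (Eventually.of_forall fun n => ?_)
  obtain ⟨hn, hn1⟩ := startTime_rat n
  rw [← h₁.mean_const _ hn hn1, ← h₂.mean_const _ hn hn1,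
    cosCoeff_sub_eq_initial hx h₁ h₂ (startTime_mem hT hn hn1)]
  exact (abs_sub _ _).trans
    (add_le_add (abs_cosCoeff_zero_le_normH _) (abs_cosCoeff_zero_le_normH _))

/-- Energy estimate for two solutions, started at a positive rational multiple of `T`. -/
lemma energy_le (hT : 0 < T) (hx : ContinuousOn x (Icc 0 1))
    (hx' : ∀ θ ∈ Icc (0 : ℝ) 1, x θ ∈ Icc (-1 : ℝ) 1)
    (h₁ : IsReflectedPath lam T x X₁ ηp₁ ηm₁) (h₂ : IsReflectedPath lam T x X₂ ηp₂ ηm₂)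
    (hN : SameNoise lam T X₁ ηp₁ ηm₁ X₂ ηp₂ ηm₂) {q : ℚ} (hq : 0 < q) (hq1 : q ≤ 1)
    (k : ℕ) {t : ℝ} (ht : t ∈ Icc (q * T) T) :
    (eigenvalue k)⁻¹ * (cosCoeff (X₁ t) k - cosCoeff (X₂ t) k) ^ 2 ≤
      2 * (normH (fun θ => X₁ (q * T) θ - X₁ 0 θ) ^ 2 +
        normH (fun θ => X₂ (q * T) θ - X₂ 0 θ) ^ 2) * Real.exp (lam ^ 2 / 4 * T) := by
  obtain ⟨ha, haT⟩ := startTime_mem hT hq hq1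
  set a : ℝ := q * T with ha_def
  set Z := extend a T fun t θ => X₁ t θ - X₂ t θ with hZ
  have hYc : ContinuousOn (fun p : ℝ × ℝ => X₁ p.1 p.2 - X₂ p.1 p.2) (slab 0 T) :=
    h₁.continuousOn.sub h₂.continuousOn
  have hZc : Continuous (Function.uncurry Z) :=
    continuous_extend (Y := fun t θ => X₁ t θ - X₂ t θ) ha haT hYc
  have hZeq : ∀ t ∈ Icc a T, ∀ m, cosCoeff (Z t) m = cosCoeff (X₁ t) m - cosCoeff (X₂ t) m := by
    intro t ht m
    have ht' : t ∈ Ioc 0 T := ⟨ha.trans_le ht.1, ht.2⟩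
    rw [hZ, cosCoeff_extend ht, cosCoeff_sub (continuousOn_slice h₁.continuousOn ht')
      (continuousOn_slice h₂.continuousOn ht')]
  have hinc : ∀ m s t, a ≤ s → s ≤ t → t ≤ T → _ := fun m s t hs hst ht =>
    increment_extend h₁ h₂ hN hT m hq hq1 hZ rfl rfl hs hst ht
  have := isFiniteMeasure_restrict_upForce h₁ h₂ (a := a) ⟨ha, haT⟩
  have := isFiniteMeasure_restrict_upForce h₂ h₁ (a := a) ⟨ha, haT⟩
  have hpt : ∀ p ∈ slab a T, Z p.1 p.2 = X₁ p.1 p.2 - X₂ p.1 p.2 := fun p hp =>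
    extend_eq ⟨hp.1.1.le, hp.1.2⟩ hp.2
  set B := 2 * (normH (fun θ => X₁ a θ - X₁ 0 θ) ^ 2 + normH (fun θ => X₂ a θ - X₂ 0 θ) ^ 2)
    with hB
  have key := energy_estimate hZc
    (fun t v => by simp only [hZ, extend, fold_neg]) (fun t v => by simp only [hZ, extend, fold_add_two])
    (C := 2) (fun t v => by
      have i₁ := h₁.mem_Icc _ (clamp_fold_mem_slab ha haT t v)
      have i₂ := h₂.mem_Icc _ (clamp_fold_mem_slab ha haT t v)
      simp only [mem_Icc] at i₁ i₂
      rw [hZ, extend, abs_le]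
      constructor <;> linarith)
    (a := a) (b := T) (lam := lam) (B := B)
    (by
      filter_upwards [ae_restrict_of_ae (ae_upForce_le h₁ h₂)] with p hp hps
      rw [hpt p hps]
      linarith)
    (by
      filter_upwards [ae_restrict_of_ae (ae_upForce_le h₂ h₁)] with p hp hps
      rw [hpt p hps]
      linarith)
    hinc
    (fun t ht => by
      have h0 := hinc 0 a t le_rfl ht.1 ht.2
      have hm := mean_eq hT hx h₁ h₂ hq hq1
      rw [← ha_def, ← hZeq a ⟨le_rfl, haT⟩] at hm
      rw [hm, eigenvalue_zero] at h0
      simpa using h0)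
    (fun n => by
      have s₁ := sum_inv_eigenvalue_mul_le_normH_sq (h₁.abs_sub_initial_le hx' ⟨ha, haT⟩) n
      have s₂ := sum_inv_eigenvalue_mul_le_normH_sq (h₂.abs_sub_initial_le hx' ⟨ha, haT⟩) n
      rw [hB]
      refine le_trans ?_ (mul_le_mul_of_nonneg_left (add_le_add s₁ s₂) zero_le_two)
      rw [← Finset.sum_add_distrib, Finset.mul_sum]
      refine Finset.sum_le_sum fun j _ => ?_
      rw [hZeq a ⟨le_rfl, haT⟩, cosCoeff_sub_eq_initial hx h₁ h₂ ⟨ha, haT⟩]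
      have hp := inv_nonneg.2 (eigenvalue_nonneg ((j : ℤ) - n))
      set u := cosCoeff (fun θ => X₁ a θ - X₁ 0 θ) ((j : ℤ) - n)
      set v := cosCoeff (fun θ => X₂ a θ - X₂ 0 θ) ((j : ℤ) - n)
      have := mul_nonneg hp (sq_nonneg (u + v))
      linarith [mul_add (eigenvalue ((j : ℤ) - n))⁻¹ (u ^ 2) (v ^ 2),
        show (eigenvalue ((j : ℤ) - n))⁻¹ * (u + v) ^ 2 +
          (eigenvalue ((j : ℤ) - n))⁻¹ * (u - v) ^ 2 =
          2 * ((eigenvalue ((j : ℤ) - n))⁻¹ * u ^ 2 + (eigenvalue ((j : ℤ) - n))⁻¹ * v ^ 2) by ring])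
    k ht
  rw [hZeq t ht] at key
  refine key.trans ?_
  have hB0 : 0 ≤ B := by positivity
  gcongr
  linarith [ht.2]

/-- Two solutions with the same noise and initial value have the same path. -/
theorem path_eq (hT : 0 < T) (hx : ContinuousOn x (Icc 0 1))
    (hx' : ∀ θ ∈ Icc (0 : ℝ) 1, x θ ∈ Icc (-1 : ℝ) 1)
    (h₁ : IsReflectedPath lam T x X₁ ηp₁ ηm₁) (h₂ : IsReflectedPath lam T x X₂ ηp₂ ηm₂)
    (hN : SameNoise lam T X₁ ηp₁ ηm₁ X₂ ηp₂ ηm₂) {p : ℝ × ℝ} (hp : p ∈ slab 0 T) :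
    X₁ p.1 p.2 = X₂ p.1 p.2 := by
  obtain ⟨t, θ⟩ := p
  obtain ⟨ht, hθ⟩ : t ∈ Ioc 0 T ∧ θ ∈ Icc (0 : ℝ) 1 := hp
  have hstart : ∀ᶠ n : ℕ in atTop, ((1 / (n + 1) : ℚ) : ℝ) * T < t :=
    ((tendsto_startTime hT).mono_right nhdsWithin_le_nhds).eventually_lt_const ht.1
  have hnat : ∀ k : ℕ, cosCoeff (X₁ t) k - cosCoeff (X₂ t) k = 0 := by
    intro k
    rcases Nat.eq_zero_or_pos k with rfl | hk
    · obtain ⟨n, hn⟩ := hstart.exists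
      obtain ⟨hq, hq1⟩ := startTime_rat n
      have ha := startTime_mem hT hq hq1
      have h0 := increment_extend h₁ h₂ hN hT 0 hq hq1 rfl rfl rfl le_rfl hn.le ht.2
      rw [cosCoeff_extend ⟨hn.le, ht.2⟩, cosCoeff_extend ⟨le_rfl, ha.2⟩,
        cosCoeff_sub (continuousOn_slice h₁.continuousOn ht)
          (continuousOn_slice h₂.continuousOn ht),
        cosCoeff_sub (continuousOn_slice h₁.continuousOn ha)
          (continuousOn_slice h₂.continuousOn ha), mean_eq hT hx h₁ h₂ hq hq1,
        eigenvalue_zero] at h0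
      simpa using h0
    · have hpos : 0 < eigenvalue (k : ℤ) := eigenvalue_pos (by omega)
      have hlim := ((((h₁.tendsto_normH.comp (tendsto_startTime hT)).pow 2).add
        ((h₂.tendsto_normH.comp (tendsto_startTime hT)).pow 2)).const_mul 2).mul_const
        (Real.exp (lam ^ 2 / 4 * T))
      simp only [ne_eq, OfNat.ofNat_ne_zero, not_false_eq_true, zero_pow, add_zero, mul_zero,
        zero_mul] at hlim
      have hle : (eigenvalue k)⁻¹ * (cosCoeff (X₁ t) k - cosCoeff (X₂ t) k) ^ 2 ≤ 0 := by
        refine ge_of_tendsto hlim ?_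
        filter_upwards [hstart] with n hn
        obtain ⟨hq, hq1⟩ := startTime_rat n
        exact energy_le hT hx hx' h₁ h₂ hN hq hq1 k ⟨hn.le, ht.2⟩
      have hsq := nonpos_of_mul_nonpos_right hle (inv_pos.2 hpos)
      exact pow_eq_zero_iff two_ne_zero |>.1 (le_antisymm hsq (sq_nonneg _))
  set Z := extend t T fun t θ => X₁ t θ - X₂ t θ with hZ
  have hYc : ContinuousOn (fun p : ℝ × ℝ => X₁ p.1 p.2 - X₂ p.1 p.2) (slab 0 T) :=
    h₁.continuousOn.sub h₂.continuousOn
  have hZt : Continuous (Z t) :=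
    (continuous_extend (Y := fun t θ => X₁ t θ - X₂ t θ) ht.1 ht.2 hYc).comp
      (by fun_prop : Continuous fun v => (t, v))
  have hcoeff : ∀ m, cosCoeff (Z t) m = 0 := by
    intro m
    rw [hZ, cosCoeff_extend ⟨le_rfl, ht.2⟩, cosCoeff_sub (continuousOn_slice h₁.continuousOn ht)
          (continuousOn_slice h₂.continuousOn ht)]
    obtain ⟨k, rfl | rfl⟩ := m.eq_nat_or_neg
    · exact hnat k
    · rw [cosCoeff_neg, cosCoeff_neg]; exact hnat k
  have hlim := tendsto_cosMean hZt (fun v => by simp only [hZ, extend, fold_neg])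
    (fun v => by simp only [hZ, extend, fold_add_two]) θ
  simp only [cosMean, hcoeff, zero_mul, mul_zero, Finset.sum_const_zero] at hlim
  have h0 := tendsto_nhds_unique hlim tendsto_const_nhds
  rw [hZ, extend_eq ⟨le_rfl, ht.2⟩ hθ] at h0
  exact sub_eq_zero.1 h0

/-! ### Uniqueness of the reflection measures -/

lemma IsReflectedPath.mean_eq_final (hT : 0 < T) (h : IsReflectedPath lam T x X₁ ηp₁ ηm₁) {t : ℝ}
    (ht : t ∈ Ioc 0 T) : cosCoeff (X₁ t) 0 = cosCoeff (X₁ T) 0 := by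
  obtain ⟨q, hq, hqt⟩ := exists_rat_btwn (div_pos ht.1 hT)
  rw [lt_div_iff₀ hT] at hqt
  have hq' : (0 : ℚ) < q := by exact_mod_cast hq
  have hq1 : q ≤ 1 := by
    have : (q : ℝ) * T < 1 * T := by linarith [ht.2]
    exact_mod_cast (lt_of_mul_lt_mul_right this hT.le).le
  have ha := startTime_mem hT hq' hq1
  have hc : Continuous fun u : ℝ => cosCoeff (extend (q * T) T X₁ (u * T)) 0 :=
    (continuous_cosCoeff (continuous_extend ha.1 ha.2 h.continuousOn) 0).comp
      (continuous_id.mul continuous_const)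
  have hr : ∀ r : ℚ, cosCoeff (extend (q * T) T X₁ (r * T)) 0 = cosCoeff (X₁ T) 0 := by
    intro r
    have e : max ((q : ℝ) * T) (min T (r * T)) = ((max q (min 1 r) : ℚ) : ℝ) * T := by
      push_cast
      rw [max_mul_of_nonneg _ _ hT.le, min_mul_of_nonneg _ _ hT.le, one_mul]
    rw [cosCoeff_congr (g' := X₁ (max (q * T) (min T (r * T))))
      (fun θ hθ => by rw [extend, fold_of_mem hθ]), e]
    exact h.mean_const _ (hq'.trans_le (le_max_left _ _)) (max_le hq1 (min_le_left _ _))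
  have heq := Rat.denseRange_cast (𝕜 := ℝ) |>.equalizer hc continuous_const (funext hr)
  have := congrFun heq (t / T)
  simp only [div_mul_cancel₀ t hT.ne'] at this
  rwa [cosCoeff_extend ⟨hqt.le, ht.2⟩] at this

/-- At each positive time a solution takes a value in `(-1,1)`. Otherwise it is constantly `1` or
constantly `-1` at that time, and, by conservation of the mean, at all times; but `f` is infinite
there. -/
lemma IsReflectedPath.exists_mem_Ioo (hT : 0 < T) (h : IsReflectedPath lam T x X₁ ηp₁ ηm₁)
    {t : ℝ} (ht : t ∈ Ioc 0 T) : ∃ θ ∈ Icc (0 : ℝ) 1, X₁ t θ ∈ Ioo (-1 : ℝ) 1 := by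
  by_contra! hcon
  have hpm : ∀ θ ∈ Icc (0 : ℝ) 1, X₁ t θ = -1 ∨ X₁ t θ = 1 := by
    intro θ hθ
    obtain ⟨l, u⟩ := h.mem_Icc (t, θ) ⟨ht, hθ⟩
    rcases l.eq_or_lt with l | l
    · exact Or.inl l.symm
    · exact Or.inr (le_antisymm u (not_lt.1 fun hu => hcon θ hθ ⟨l, hu⟩))
  have hconst : ∀ θ ∈ Icc (0 : ℝ) 1, X₁ t θ = X₁ t 0 := by
    intro θ hθ
    by_contra hne
    have h0 : (0 : ℝ) ∈ Icc (0 : ℝ) 1 := ⟨le_rfl, zero_le_one⟩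
    have himg := isPreconnected_Icc.image _ (continuousOn_slice h.continuousOn ht)
    have hzero : (0 : ℝ) ∈ X₁ t '' Icc 0 1 := by
      rcases hpm θ hθ with e | e <;> rcases hpm 0 h0 with e' | e'
      · exact absurd (e.trans e'.symm) hne
      · exact himg.Icc_subset ⟨θ, hθ, e⟩ ⟨0, h0, e'⟩ ⟨by norm_num, by norm_num⟩
      · exact himg.Icc_subset ⟨0, h0, e'⟩ ⟨θ, hθ, e⟩ ⟨by norm_num, by norm_num⟩
      · exact absurd (e.trans e'.symm) hne
    obtain ⟨θ', hθ', e⟩ := hzero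
    rcases hpm θ' hθ' with e' | e' <;> linarith
  set σ := X₁ t 0 with hσ
  have hσ1 : σ = -1 ∨ σ = 1 := hpm 0 ⟨le_rfl, zero_le_one⟩
  have hmean : ∀ s ∈ Ioc 0 T, cosCoeff (X₁ s) 0 = σ := by
    intro s hs
    rw [h.mean_eq_final hT hs, ← h.mean_eq_final hT ht,
      cosCoeff_congr (g' := fun _ => σ) hconst, cosCoeff, pairing]
    simp [cosMode_zero]
  have ha : 0 < T / 2 := half_pos hT
  have hsub : strip (T / 2) T ⊆ slab 0 T := strip_subset_slab ha le_rfl le_rfl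
  have hfin : IsFiniteMeasure ((volume : Measure (ℝ × ℝ)).restrict (strip (T / 2) T)) :=
    ⟨by
      rw [Measure.restrict_apply_univ]
      exact (isCompact_Icc.prod isCompact_Icc).measure_lt_top⟩
  have hint : IntegrableOn (fun p : ℝ × ℝ => 1 - σ * X₁ p.1 p.2) (strip (T / 2) T) :=
    (integrable_const 1).sub ((h.integrableOn.mono_set hsub).const_mul σ)
  have hpos : ∀ᵐ p ∂(volume.restrict (strip (T / 2) T)), 0 < 1 - σ * X₁ p.1 p.2 := by
    filter_upwards [ae_restrict_of_ae_restrict_of_subset hsub h.f_finite] with p hp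
    obtain ⟨l, u⟩ := mem_Ioo_of_f_finite hp
    rcases hσ1 with e | e <;> rw [e] <;> linarith
  have hzero : ∫ p in strip (T / 2) T, (1 - σ * X₁ p.1 p.2) = 0 := by
    rw [setIntegral_strip_eq (by linarith) hint]
    refine (intervalIntegral.integral_congr (g := fun _ => (0 : ℝ)) fun r hr => ?_).trans (by simp)
    rw [uIcc_of_le (by linarith)] at hr
    have hr' : r ∈ Ioc 0 T := ⟨ha.trans_le hr.1, hr.2⟩
    have hXi : IntervalIntegrable (X₁ r) volume 0 1 := ContinuousOn.intervalIntegrable (by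
      rw [uIcc_of_le zero_le_one]; exact continuousOn_slice h.continuousOn hr')
    have hm := hmean r hr'
    simp only [cosCoeff, pairing, cosMode_zero, mul_one] at hm
    simp only
    rw [intervalIntegral.integral_sub intervalIntegrable_const (hXi.const_mul σ),
      intervalIntegral.integral_const_mul, hm]
    rcases hσ1 with e | e <;> simp [e]
  rw [integral_eq_zero_iff_of_nonneg_ae (hpos.mono fun _ hp => hp.le) hint] at hzero
  have hfalse : ∀ᵐ p ∂(volume.restrict (strip (T / 2) T)), False := by
    filter_upwards [hpos, hzero] with p h₁ h₂
    rw [h₂] at h₁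
    exact lt_irrefl _ h₁
  rw [ae_iff] at hfalse
  simp only [not_false_eq_true, ofPred_true, Measure.restrict_apply_univ] at hfalse
  rw [strip, Measure.volume_eq_prod, Measure.prod_prod] at hfalse
  simp at hfalse
  linarith

/-- Where `X₁ = X₂`, the forces only act at points where `X₁ = ±1`. -/
lemma ae_upForce_notMem_Ioo (h₁ : IsReflectedPath lam T x X₁ ηp₁ ηm₁)
    (h₂ : IsReflectedPath lam T x X₂ ηp₂ ηm₂)
    (hX : ∀ p ∈ slab 0 T, X₁ p.1 p.2 = X₂ p.1 p.2) :
    ∀ᵐ p ∂upForce lam T X₁ X₂ ηm₁ ηp₂, X₁ p.1 p.2 ∉ Ioo (-1 : ℝ) 1 := by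
  rw [upForce, ae_add_measure_iff, ae_add_measure_iff]
  refine ⟨⟨?_, ?_⟩, ?_⟩
  · filter_upwards [h₁.contact_minus] with p hp h
    exact lt_irrefl _ (hp ▸ h.1)
  · filter_upwards [h₂.contact_plus, h₂.carrier_plus] with p hp hp' h
    rw [hX p hp', hp] at h
    exact lt_irrefl _ h.2
  · rw [ae_withDensity_iff' (integrableOn_logGap h₁ h₂).aemeasurable.ennreal_ofReal]
    filter_upwards [ae_restrict_mem (measurableSet_slab 0 T)] with p hp hne
    exact absurd (by simp [logGap, hX p hp]) hne

lemma upForce_eq_add (hX : ∀ p ∈ slab 0 T, X₁ p.1 p.2 = X₂ p.1 p.2) :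
    upForce lam T X₁ X₂ ηm₁ ηp₂ = ηm₁ + ηp₂ := by
  have : (fun p => ENNReal.ofReal (logGap lam X₁ X₂ p)) =ᵐ[volume.restrict (slab 0 T)] 0 := by
    filter_upwards [ae_restrict_mem (measurableSet_slab 0 T)] with p hp
    simp [logGap, hX p hp]
  rw [upForce, withDensity_congr_ae this, withDensity_zero, add_zero]

/-- Measures with a common separating set are determined by their sum. -/
lemma eq_of_add_eq_of_separated {μ₁ μ₂ ν₁ ν₂ : Measure (ℝ × ℝ)} (h : μ₁ + ν₁ = μ₂ + ν₂)
    {N : Set (ℝ × ℝ)} (hμ₁ : ∀ᵐ p ∂μ₁, p ∈ N) (hμ₂ : ∀ᵐ p ∂μ₂, p ∈ N)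
    (hν₁ : ∀ᵐ p ∂ν₁, p ∉ N) (hν₂ : ∀ᵐ p ∂ν₂, p ∉ N) : μ₁ = μ₂ := by
  have hz : ∀ ν : Measure (ℝ × ℝ), (∀ᵐ p ∂ν, p ∉ N) → ν.restrict N = 0 := fun ν hν =>
    Measure.restrict_eq_zero.2 (by simpa [ae_iff] using hν)
  have := congrArg (fun ρ : Measure (ℝ × ℝ) => ρ.restrict N) h
  simpa only [Measure.restrict_add, Measure.restrict_eq_self_of_ae_mem hμ₁,
    Measure.restrict_eq_self_of_ae_mem hμ₂, hz ν₁ hν₁, hz ν₂ hν₂, add_zero] using this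

/-- For solutions with the same noise and path, the reflections appear in the equation only through
these sums, up to a multiple of Lebesgue measure in space. -/
lemma reflection_sum_eq (hT : 0 < T)
    (h₁ : IsReflectedPath lam T x X₁ ηp₁ ηm₁) (h₂ : IsReflectedPath lam T x X₂ ηp₂ ηm₂)
    (hN : SameNoise lam T X₁ ηp₁ ηm₁ X₂ ηp₂ ηm₂)
    (hX : ∀ p ∈ slab 0 T, X₁ p.1 p.2 = X₂ p.1 p.2) :
    ηm₁ + ηp₂ = ηm₂ + ηp₁ := by
  have hX' : ∀ p ∈ slab 0 T, X₂ p.1 p.2 = X₁ p.1 p.2 := fun p hp => (hX p hp).symm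
  have hpiece : ∀ n : ℕ, (ηm₁ + ηp₂).restrict (slab (((1 / (n + 1) : ℚ) : ℝ) * T) T) =
      (ηm₂ + ηp₁).restrict (slab (((1 / (n + 1) : ℚ) : ℝ) * T) T) := by
    intro n
    obtain ⟨hq, hq1⟩ := startTime_rat n
    obtain ⟨ha, haT⟩ := startTime_mem hT hq hq1
    set q : ℚ := 1 / (n + 1)
    set a : ℝ := q * T with ha_def
    have := isFiniteMeasure_restrict_upForce h₁ h₂ (a := a) ⟨ha, haT⟩
    have := isFiniteMeasure_restrict_upForce h₂ h₁ (a := a) ⟨ha, haT⟩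
    have hzero : ∀ t ∈ Icc a T, ∀ m,
        cosCoeff (extend a T (fun t θ => X₁ t θ - X₂ t θ) t) m = 0 := by
      intro t ht m
      rw [cosCoeff_congr (g' := fun _ => 0) (fun θ hθ => ?_)]
      · simp [cosCoeff, pairing]
      · rw [extend_eq ht hθ, hX (t, θ) ⟨⟨ha.trans_le ht.1, ht.2⟩, hθ⟩, sub_self]
    have key := restrict_slab_eq (a := a) (b := T)
      (α := (upForce lam T X₁ X₂ ηm₁ ηp₂).restrict (strip a T))
      (β := (upForce lam T X₂ X₁ ηm₂ ηp₁).restrict (strip a T))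
      (fun m s t hm hs hst ht => by
        have hinc := increment_extend h₁ h₂ hN hT m hq hq1 rfl rfl rfl hs hst ht
        rw [← ha_def, hzero t ⟨hs.trans hst, ht⟩, hzero s ⟨hs, hst.trans ht⟩,
          intervalIntegral.integral_congr (g := fun _ => (0 : ℝ)) (fun r hr => by
            rw [uIcc_of_le hst] at hr
            simp only
            rw [hzero r ⟨hs.trans hr.1, hr.2.trans ht⟩, mul_zero])] at hinc
        simp only [sub_self, intervalIntegral.integral_zero, zero_add] at hinc
        have hpos := eigenvalue_pos hm
        have := (mul_eq_zero.1 hinc.symm).resolve_left (by positivity)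
        exact sub_eq_zero.1 this)
      (fun t₀ ht₀ => by
        have ht₀' : t₀ ∈ Ioc 0 T := ⟨ha.trans_le ht₀.1, ht₀.2⟩
        obtain ⟨θ₀, hθ₀, hmem⟩ := h₁.exists_mem_Ioo hT ht₀'
        have hnhds := h₁.continuousOn (t₀, θ₀) ⟨ht₀', hθ₀⟩ (isOpen_Ioo.mem_nhds hmem)
        rw [mem_map, Metric.mem_nhdsWithin_iff] at hnhds
        obtain ⟨r, hr, hball⟩ := hnhds
        have hbox : ∀ p ∈ slab a T ∩ Metric.ball t₀ r ×ˢ (Metric.ball θ₀ r ∩ Icc 0 1),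
            X₁ p.1 p.2 ∈ Ioo (-1 : ℝ) 1 := by
          rintro p ⟨hp, hp₁, hp₂⟩
          refine hball ⟨?_, slab_mono ha.le le_rfl hp⟩
          rw [← ball_prod_same]
          exact ⟨hp₁, hp₂.1⟩
        have hnull : ∀ μ : Measure (ℝ × ℝ), (∀ᵐ p ∂μ, X₁ p.1 p.2 ∉ Ioo (-1 : ℝ) 1) →
            μ.restrict (strip a T)
              (slab a T ∩ Metric.ball t₀ r ×ˢ (Metric.ball θ₀ r ∩ Icc 0 1)) = 0 := by
          intro μ hμ
          refine measure_mono_null (fun p hp => ?_) (ae_iff.1 (ae_restrict_of_ae hμ))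
          exact not_not.2 (hbox p hp)
        refine ⟨r, hr, Metric.ball θ₀ r ∩ Icc 0 1, inter_subset_right,
          measurableSet_ball.inter measurableSet_Icc, ?_,
          hnull _ (ae_upForce_notMem_Ioo h₁ h₂ hX), hnull _ ?_⟩
        · have hcl : θ₀ ∈ closure (Ioo (0 : ℝ) 1) := by
            rw [closure_Ioo (by norm_num)]; exact hθ₀
          have hne := mem_closure_iff.1 hcl _ Metric.isOpen_ball (Metric.mem_ball_self hr)
          exact (((Metric.isOpen_ball.inter isOpen_Ioo).measure_pos volume hne).trans_le
            (measure_mono (inter_subset_inter_right _ Ioo_subset_Icc_self))).ne'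
        · rw [upForce_eq_add hX', ae_add_measure_iff]
          constructor
          · filter_upwards [h₂.contact_minus, h₂.carrier_minus] with p hp hp' h
            rw [hX p hp', hp] at h
            exact lt_irrefl _ h.1
          · filter_upwards [h₁.contact_plus] with p hp h
            exact lt_irrefl _ (hp ▸ h.2))
    rwa [upForce_eq_add hX, upForce_eq_add hX', Measure.restrict_restrict (measurableSet_slab a T),
      Measure.restrict_restrict (measurableSet_slab a T),
      inter_eq_left.2 (slab_subset_strip a T)] at key
  have hU : ⋃ n : ℕ, slab (((1 / (n + 1) : ℚ) : ℝ) * T) T = slab 0 T := by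
    ext p
    simp only [mem_iUnion]
    constructor
    · rintro ⟨n, hp⟩
      exact slab_mono (startTime_mem hT (startTime_rat n).1
        (startTime_rat n).2).1.le le_rfl hp
    · intro hp
      obtain ⟨n, hn⟩ := (((tendsto_startTime hT).mono_right
        nhdsWithin_le_nhds).eventually_lt_const hp.1.1).exists
      exact ⟨n, ⟨hn, hp.1.2⟩, hp.2⟩
  have hres := (Measure.restrict_iUnion_congr).2 hpiece
  rwa [hU, Measure.restrict_eq_self_of_ae_mem
      (ae_add_measure_iff.2 ⟨h₁.carrier_minus, h₂.carrier_plus⟩),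
    Measure.restrict_eq_self_of_ae_mem
      (ae_add_measure_iff.2 ⟨h₂.carrier_minus, h₁.carrier_plus⟩)] at hres

theorem reflection_eq (hT : 0 < T)
    (h₁ : IsReflectedPath lam T x X₁ ηp₁ ηm₁) (h₂ : IsReflectedPath lam T x X₂ ηp₂ ηm₂)
    (hN : SameNoise lam T X₁ ηp₁ ηm₁ X₂ ηp₂ ηm₂)
    (hX : ∀ p ∈ slab 0 T, X₁ p.1 p.2 = X₂ p.1 p.2) : ηp₁ = ηp₂ ∧ ηm₁ = ηm₂ := by
  have hsum := reflection_sum_eq hT h₁ h₂ hN hX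
  set N : Set (ℝ × ℝ) := {p | X₁ p.1 p.2 = -1}
  have m₁ : ∀ᵐ p ∂ηm₁, p ∈ N := h₁.contact_minus
  have m₂ : ∀ᵐ p ∂ηm₂, p ∈ N := by
    filter_upwards [h₂.contact_minus, h₂.carrier_minus] with p hp hp'
    exact (hX p hp').trans hp
  have p₁ : ∀ᵐ p ∂ηp₁, p ∉ N := by
    filter_upwards [h₁.contact_plus] with p hp h
    have : (1 : ℝ) = -1 := hp.symm.trans h
    norm_num at this
  have p₂ : ∀ᵐ p ∂ηp₂, p ∉ N := by
    filter_upwards [h₂.contact_plus, h₂.carrier_plus] with p hp hp' h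
    have : (1 : ℝ) = -1 := hp.symm.trans ((hX p hp').symm.trans h)
    norm_num at this
  refine ⟨?_, eq_of_add_eq_of_separated hsum m₁ m₂ p₂ p₁⟩
  have hsum' : ηp₁ + ηm₂ = ηp₂ + ηm₁ := by rw [add_comm, ← hsum, add_comm]
  exact eq_of_add_eq_of_separated (N := Nᶜ) hsum' p₁ p₂ (m₂.mono fun _ hp => not_not.2 hp)
    (m₁.mono fun _ hp => not_not.2 hp)

end difference

/-! ### From weak solutions to paths -/

lemma memLp_of_continuous {g : ℝ → ℝ} (hg : Continuous g) : MemLp g 2 spaceMeasure := by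
  obtain ⟨C, hC⟩ := (isCompact_Icc (a := (0 : ℝ)) (b := 1)).exists_bound_of_continuousOn
    hg.continuousOn
  refine MemLp.of_bound hg.aestronglyMeasurable C ?_
  filter_upwards [ae_restrict_mem measurableSet_Icc] with θ hθ using hC θ hθ

/-- The derivative of `cosMode m`. -/
noncomputable def cosModeDeriv (m : ℤ) (θ : ℝ) : ℝ := -(m * Real.pi) * Real.sin (m * Real.pi * θ)

@[fun_prop]
lemma continuous_cosModeDeriv (m : ℤ) : Continuous (cosModeDeriv m) := by
  unfold cosModeDeriv; fun_prop

lemma isNeumann_cosMode (m : ℤ) (c : ℝ) :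
    IsNeumann (fun θ => c * cosMode m θ) (fun θ => c * cosModeDeriv m θ)
      (fun θ => c * -eigenvalue m * cosMode m θ) where
  memLp := memLp_of_continuous (by fun_prop)
  memLp_deriv := memLp_of_continuous (by fun_prop)
  memLp_deriv_two := memLp_of_continuous (by fun_prop)
  eq_integral θ _ := by
    have hd : ∀ r, HasDerivAt (fun θ => c * cosMode m θ) (c * cosModeDeriv m r) r := fun r => by
      have h1 := ((hasDerivAt_id r).const_mul ((m : ℝ) * Real.pi)).cos.const_mul c
      refine h1.congr_deriv ?_
      simp only [cosModeDeriv, id_eq]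
      ring
    rw [intervalIntegral.integral_eq_sub_of_hasDerivAt (fun r _ => hd r)
      (Continuous.intervalIntegrable (by fun_prop) _ _)]
    ring
  deriv_eq_integral θ _ := by
    have hd : ∀ r, HasDerivAt (fun θ => c * cosModeDeriv m θ)
        (c * -eigenvalue m * cosMode m r) r := fun r => by
      have h1 := ((((hasDerivAt_id r).const_mul ((m : ℝ) * Real.pi)).sin).const_mul
        (-((m : ℝ) * Real.pi))).const_mul c
      refine h1.congr_deriv ?_
      simp only [cosMode, eigenvalue, id_eq]
      ring
    rw [intervalIntegral.integral_eq_sub_of_hasDerivAt (fun r _ => hd r)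
      (Continuous.intervalIntegrable (by fun_prop) _ _)]
    ring
  left_boundary := by simp [cosModeDeriv]
  right_boundary := by simp [cosModeDeriv, Real.sin_int_mul_pi]

/-- The class of `B (cosMode m)` in `L²(0,1)`. -/
noncomputable def noiseDirection (m : ℤ) : L2 :=
  (memLp_of_continuous (continuous_cosModeDeriv m)).toLp (cosModeDeriv m)

lemma noiseDirection_zero : noiseDirection 0 = 0 := by
  rw [Lp.eq_zero_iff_ae_eq_zero]
  filter_upwards [MemLp.coeFn_toLp (memLp_of_continuous (continuous_cosModeDeriv 0))] with θ hθ
  rw [noiseDirection, hθ]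
  simp [cosModeDeriv]

section weak
variable {Ω : Type*} {mΩ : MeasurableSpace Ω} {P : Measure Ω} {lam T : ℝ}
  {𝓕 : Filtration (Icc (0 : ℝ) T) mΩ} {x : ℝ → ℝ} {X : Ω → ℝ → ℝ → ℝ}
  {ηp ηm : Ω → Measure (ℝ × ℝ)} {W : Icc (0 : ℝ) T → L2 → Ω → ℝ}

lemma IsCylindricalWiener.ae_eq_zero (hW : IsCylindricalWiener P T W) (t : Icc (0 : ℝ) T) :
    ∀ᵐ ω ∂P, W t 0 ω = 0 := by
  have hL := (hW.gaussian.hasGaussianLaw_eval (t, (0 : L2))).memLp_two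
  have h0 : ∫ ω, W t 0 ω * W t 0 ω ∂P = 0 := by
    rw [hW.covariance, inner_zero_left, mul_zero]
  have hi : Integrable (fun ω => W t 0 ω * W t 0 ω) P := hL.integrable_mul hL
  rw [integral_eq_zero_iff_of_nonneg (fun ω => mul_self_nonneg _) hi] at h0
  filter_upwards [h0] with ω hω
  exact mul_self_eq_zero.1 hω

/-- The equation tested against `cosMode m`. -/
lemma IsWeakSolution.ae_noiseIncrement (h : IsWeakSolution P lam T 𝓕 x X ηp ηm W) (m : ℤ)
    (δ t : Icc (0 : ℝ) T) (hδ : 0 < (δ : ℝ)) (hδt : δ ≤ t) :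
    ∀ᵐ ω ∂P, noiseIncrement lam (X ω) (ηp ω) (ηm ω) m δ t =
      -(W t (noiseDirection m) ω - W δ (noiseDirection m) ω) := by
  have n₁ : IsNeumann (cosMode m) (cosModeDeriv m) (fun θ => -eigenvalue m * cosMode m θ) := by
    simpa using isNeumann_cosMode m 1
  have n₂ : IsNeumann (fun θ => -eigenvalue m * cosMode m θ)
      (fun θ => -eigenvalue m * cosModeDeriv m θ) (fun θ => eigenvalue m ^ 2 * cosMode m θ) := by
    have := isNeumann_cosMode m (-eigenvalue m)
    simpa [← sq] using this
  have heq := h.equation _ _ _ _ _ n₁ n₂ (noiseDirection m) (MemLp.coeFn_toLp _) δ t hδ hδt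
  have hst : (δ : ℝ) ≤ t := hδt
  filter_upwards [heq, h.f_integrable] with ω hω hf
  have hsub : strip (δ : ℝ) t ⊆ strip 0 T :=
    prod_mono (Icc_subset_Icc δ.2.1 t.2.2) Subset.rfl
  have hfc : IntegrableOn
      (fun p : ℝ × ℝ => cosMode m p.2 * (f lam (X ω p.1 p.2)).toReal) (strip δ t) :=
    (hf.mono_set hsub).bdd_mul ((continuous_cosMode m).comp continuous_snd).aestronglyMeasurable
      (ae_of_all _ fun p => abs_cosMode_le m p.2)
  have e₁ : ∀ s, pairing (X ω s) (fun θ => eigenvalue m ^ 2 * cosMode m θ) =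
      eigenvalue m ^ 2 * cosCoeff (X ω s) m := fun s => by
    simp only [pairing, cosCoeff, mul_left_comm _ (eigenvalue m ^ 2),
      intervalIntegral.integral_const_mul]
  have e₂ : ∫ s in (δ : ℝ)..t, pairing (fun θ => -eigenvalue m * cosMode m θ)
      (fun θ => (f lam (X ω s θ)).toReal) =
      -eigenvalue m * ∫ p in strip δ t, cosMode m p.2 * (f lam (X ω p.1 p.2)).toReal := by
    rw [setIntegral_strip_eq hst hfc]
    simp only [pairing, mul_assoc, intervalIntegral.integral_const_mul]
  simp only [e₁, e₂, integral_const_mul, intervalIntegral.integral_const_mul] at hω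
  have e₃ : ∀ s, pairing (X ω s) (cosMode m) = cosCoeff (X ω s) m := fun s => rfl
  rw [e₃, e₃] at hω
  unfold noiseIncrement
  linear_combination hω

/-- The point of `[0,T]` with time `qT`. -/
noncomputable def ratTime (hT : 0 < T) (q : ℚ) (hq : 0 < q) (hq1 : q ≤ 1) : Icc (0 : ℝ) T :=
  ⟨q * T, (startTime_mem hT hq hq1).1.le, (startTime_mem hT hq hq1).2⟩

theorem IsWeakSolution.ae_isReflectedPath (hT : 0 < T)
    (h : IsWeakSolution P lam T 𝓕 x X ηp ηm W) :
    ∀ᵐ ω ∂P, IsReflectedPath lam T x (X ω) (ηp ω) (ηm ω) := by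
  have hmean : ∀ᵐ ω ∂P, ∀ q : ℚ, 0 < q → q ≤ 1 →
      cosCoeff (X ω (q * T)) 0 = cosCoeff (X ω T) 0 := by
    simp only [ae_all_iff]
    intro q hq hq1
    have hle : ratTime hT q hq hq1 ≤ (⟨T, hT.le, le_rfl⟩ : Icc (0 : ℝ) T) :=
      (startTime_mem hT hq hq1).2
    filter_upwards [h.ae_noiseIncrement 0 _ _ (startTime_mem hT hq hq1).1 hle,
      h.wiener.ae_eq_zero ⟨T, hT.le, le_rfl⟩, h.wiener.ae_eq_zero (ratTime hT q hq hq1)]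
      with ω h₁ h₂ h₃
    rw [noiseDirection_zero, h₂, h₃, noiseIncrement, eigenvalue_zero] at h₁
    simp only [ratTime] at h₁
    linarith
  filter_upwards [h.continuousOn, h.mem_Icc, h.continuous_H, h.initial, h.carrier_plus,
    h.carrier_minus, h.finite_plus, h.finite_minus, h.f_finite, h.f_integrable, h.contact_minus,
    h.contact_plus, hmean] with ω hc hmem hH hini hcp hcm hfp hfm hff hfi hkm hkp hm
  have cp : ∀ᵐ p ∂ηp ω, p ∈ slab 0 T := hcp
  have cm : ∀ᵐ p ∂ηm ω, p ∈ slab 0 T := hcm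
  have hcon : ∀ (μ : Measure (ℝ × ℝ)) (g : ℝ × ℝ → ℝ), (∀ᵐ p ∂μ, p ∈ slab 0 T) →
      ContinuousOn g (slab 0 T) → ∫⁻ p in strip 0 T, ENNReal.ofReal (g p) ∂μ = 0 →
      ∀ᵐ p ∂μ, g p ≤ 0 := by
    intro μ g hμ hg hz
    have hz' : ∫⁻ p in slab 0 T, ENNReal.ofReal (g p) ∂μ = 0 :=
      le_antisymm ((lintegral_mono_set (slab_subset_strip 0 T)).trans hz.le) zero_le
    rw [lintegral_eq_zero_iff' (hg.aemeasurable (measurableSet_slab 0 T)).ennreal_ofReal,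
      Measure.restrict_eq_self_of_ae_mem hμ] at hz'
    filter_upwards [hz'] with p hp using ENNReal.ofReal_eq_zero.1 hp
  exact
    { continuousOn := hc
      mem_Icc := fun p hp => hmem p.1 hp.1 p.2 hp.2
      tendsto_normH := hH 0 ⟨le_rfl, hT.le⟩
      initial := hini
      carrier_plus := cp
      carrier_minus := cm
      finite_plus := hfp
      finite_minus := hfm
      f_finite := ae_restrict_of_ae_restrict_of_subset (slab_subset_strip 0 T) hff
      f_integrable := hfi.mono_set (slab_subset_strip 0 T)
      contact_minus := by
        filter_upwards [cm, hcon _ (fun p => 1 + X ω p.1 p.2) cm (continuousOn_const.add hc) hkm]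
          with p hp hp'
        linarith [(hmem p.1 hp.1 p.2 hp.2).1]
      contact_plus := by
        filter_upwards [cp, hcon _ (fun p => 1 - X ω p.1 p.2) cp (continuousOn_const.sub hc) hkp]
          with p hp hp'
        linarith [(hmem p.1 hp.1 p.2 hp.2).2]
      mean_const := hm }

theorem ae_sameNoise {𝓕₁ 𝓕₂ : Filtration (Icc (0 : ℝ) T) mΩ} {X₁ X₂ : Ω → ℝ → ℝ → ℝ}
    {ηp₁ ηm₁ ηp₂ ηm₂ : Ω → Measure (ℝ × ℝ)} (hT : 0 < T)
    (h₁ : IsWeakSolution P lam T 𝓕₁ x X₁ ηp₁ ηm₁ W)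
    (h₂ : IsWeakSolution P lam T 𝓕₂ x X₂ ηp₂ ηm₂ W) :
    ∀ᵐ ω ∂P, SameNoise lam T (X₁ ω) (ηp₁ ω) (ηm₁ ω) (X₂ ω) (ηp₂ ω) (ηm₂ ω) := by
  simp only [SameNoise, ae_all_iff]
  intro m q r hq hqr hr
  have hle : ratTime hT q hq (hqr.trans hr) ≤ ratTime hT r (hq.trans_le hqr) hr :=
    mul_le_mul_of_nonneg_right (by exact_mod_cast hqr) hT.le
  have hpos := (startTime_mem hT hq (hqr.trans hr)).1
  filter_upwards [h₁.ae_noiseIncrement m _ _ hpos hle, h₂.ae_noiseIncrement m _ _ hpos hle]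
    with ω e₁ e₂
  exact e₁.trans e₂.symm

end weak

end ReflectedCahnHilliard

theorem proposition2p1 {Ω : Type*} {mΩ : MeasurableSpace Ω} (P : Measure Ω)
    [IsProbabilityMeasure P] (lam T : ℝ) (hT : 0 < T)
    (x : ℝ → ℝ) (hx : ContinuousOn x (Icc 0 1)) (hx' : ∀ θ ∈ Icc (0 : ℝ) 1, x θ ∈ Icc (-1 : ℝ) 1)
    (𝓕₁ 𝓕₂ : Filtration (Icc (0 : ℝ) T) mΩ)
    (X₁ X₂ : Ω → ℝ → ℝ → ℝ) (ηp₁ ηm₁ ηp₂ ηm₂ : Ω → Measure (ℝ × ℝ))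
    (W : Icc (0 : ℝ) T → ReflectedCahnHilliard.L2 → Ω → ℝ)
    (h₁ : ReflectedCahnHilliard.IsWeakSolution P lam T 𝓕₁ x X₁ ηp₁ ηm₁ W)
    (h₂ : ReflectedCahnHilliard.IsWeakSolution P lam T 𝓕₂ x X₂ ηp₂ ηm₂ W) :
    ∀ᵐ ω ∂P, (∀ t ∈ Icc 0 T, ∀ θ ∈ Icc (0 : ℝ) 1, X₁ ω t θ = X₂ ω t θ) ∧
      ηp₁ ω = ηp₂ ω ∧ ηm₁ ω = ηm₂ ω := by
  filter_upwards [h₁.ae_isReflectedPath hT, h₂.ae_isReflectedPath hT,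
    ReflectedCahnHilliard.ae_sameNoise hT h₁ h₂] with ω r₁ r₂ hN
  have hX : ∀ p ∈ ReflectedCahnHilliard.slab 0 T, X₁ ω p.1 p.2 = X₂ ω p.1 p.2 :=
    fun p hp => ReflectedCahnHilliard.path_eq hT hx hx' r₁ r₂ hN hp
  refine ⟨fun t ht θ hθ => ?_, ReflectedCahnHilliard.reflection_eq hT r₁ r₂ hN hX⟩
  rcases ht.1.eq_or_lt with rfl | ht0
  · rw [r₁.initial θ hθ, r₂.initial θ hθ]
  · exact hX (t, θ) ⟨⟨ht0, ht.2⟩, hθ⟩
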